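/- Let $a=\frac1{\sqrt2}\left(\frac{d}{dx}+x\right)$ and $a^*=\frac1{\sqrt2}\left(-\frac{d}{dx}+x\right)$ be the annihilation and creation operators in $L^2(\mathbb R)$, and let $\mathcal H=\mathbb C^2\otimes L^2(\mathbb R)$. Let $\sigma_x,\sigma_z$ be the Pauli matrices. For $\alpha,\beta>0$ let $$Q^{\rm 1pNH}_{\alpha\beta}=\begin{pmatrix}\alpha&0\\0&\beta\end{pmatrix}\otimes\left(a^*a+\tfrac12\right)+\tfrac12\begin{pmatrix}0&-1\\1&0\end{pmatrix}\otimes(a-a^*)$$ be the one-particle non-commutative harmonic oscillator, with spectrum $\sigma(Q^{\rm 1pNH}_{\alpha\beta})\subset\mathbb R$, and for $\lambda\in\mathbb R$ let $$H^{\rm 1p}_{\alpha\beta}(\lambda)=\triangle\,\sigma_z\otimes 1+1\otimes\left(a^*a+\tfrac12\right)+g\,\sigma_x\otimes(a+a^*),\qquad \triangle=\frac{\alpha-\beta}{2\alpha\beta}\lambda,\quad g=\frac1{2\sqrt{\alpha\beta}},$$ be the one-photon quantum Rabi Hamiltonian with these parameters; both operators have the domain $\mathbb C^2\otimes D(a^*a)$.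 Let $\mathcal H_{\alpha\beta}$ be the vector space $\mathcal H$ with the inner product $(f,g)_{\alpha\beta}=(f,\gamma_{\alpha\beta}g)_{\mathcal H}$, where $\gamma_{\alpha\beta}=\begin{pmatrix}1/\alpha&0\\0&1/\beta\end{pmatrix}\otimes 1$, and let $$\tilde I_{\alpha\beta}=c\otimes e^{-i(\pi/2)a^*a},\qquad c=\begin{pmatrix}\sqrt\alpha&0\\0&\sqrt\beta\end{pmatrix}e^{i\frac{\pi}{4}\sigma_z}.$$ Let $\tilde P_{\frac{\alpha+\beta}{2\alpha\beta}\lambda}$ be the orthogonal projection in $\mathcal H_{\alpha\beta}$ onto the eigenspace $\tilde{\mathcal E}^\lambda=\ker\left(H^{\rm 1p}_{\alpha\beta}(\lambda)-\frac{\alpha+\beta}{2\alpha\beta}\lambda\right)$. Theorem. Let $\alpha,\beta>0$. Then $\tilde I_{\alpha\beta}$ is a unitary operator from $\mathcal H$ onto $\mathcal H_{\alpha\beta}$, the space $\mathcal H_{\alpha\beta}$ is the Hilbert space direct sum of the subspaces $\tilde{\mathcal E}^\lambda$, $\lambda\in\sigma(Q^{\rm 1pNH}_{\alpha\beta})$,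 and $$\tilde I_{\alpha\beta}\,Q^{\rm 1pNH}_{\alpha\beta}\,\tilde I_{\alpha\beta}^{-1}=\frac{2\alpha\beta}{\alpha+\beta}\bigoplus_{\lambda\in\sigma(Q^{\rm 1pNH}_{\alpha\beta})}H^{\rm 1p}_{\alpha\beta}(\lambda)\,\tilde P_{\frac{\alpha+\beta}{2\alpha\beta}\lambda}$$ holds as an equality of unbounded operators in $\mathcal H_{\alpha\beta}$, domains included. -/

import Mathlib

open MeasureTheory
open scoped SchwartzMap

noncomputable section

namespace NcHO

/-! ### Unbounded operators -/

section Operators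

variable {E F : Type*} [AddCommGroup E] [Module ℂ E] [AddCommGroup F] [Module ℂ F]

/-- The product `T S` of unbounded operators, with its natural domain
`{f ∈ D(S) | S f ∈ D(T)}`. -/
def opMul (T S : E →ₗ.[ℂ] E) : E →ₗ.[ℂ] E where
  domain :=
    { carrier := {f | ∃ h : f ∈ S.domain, S ⟨f, h⟩ ∈ T.domain}
      zero_mem' := ⟨S.domain.zero_mem, by
        have h : S ⟨0, S.domain.zero_mem⟩ = 0 := S.map_zero
        rw [h]; exact T.domain.zero_mem⟩
      add_mem' := by
        rintro f g ⟨hf, hf'⟩ ⟨hg, hg'⟩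
        refine ⟨S.domain.add_mem hf hg, ?_⟩
        have h : S ⟨f + g, S.domain.add_mem hf hg⟩ = S ⟨f, hf⟩ + S ⟨g, hg⟩ :=
          S.map_add ⟨f, hf⟩ ⟨g, hg⟩
        rw [h]; exact T.domain.add_mem hf' hg'
      smul_mem' := by
        rintro c f ⟨hf, hf'⟩
        refine ⟨S.domain.smul_mem c hf, ?_⟩
        have h : S ⟨c • f, S.domain.smul_mem c hf⟩ = c • S ⟨f, hf⟩ := S.map_smul c ⟨f, hf⟩
        rw [h]; exact T.domain.smul_mem c hf' }
  toFun :=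
    { toFun := fun f => T ⟨S ⟨f.1, f.2.1⟩, f.2.2⟩
      map_add' := fun f g => by
        rw [← T.map_add]
        congr 1
        ext
        exact S.map_add ⟨f.1, f.2.1⟩ ⟨g.1, g.2.1⟩
      map_smul' := fun c f => by
        rw [RingHom.id_apply, ← T.map_smul]
        congr 1
        ext
        exact S.map_smul c ⟨f.1, f.2.1⟩ }

/-- The operator `V T V⁻¹`, with domain `V D(T)`, for a linear bijection `V`. -/
def conj (V : E ≃ₗ[ℂ] F) (T : E →ₗ.[ℂ] E) : F →ₗ.[ℂ] F where
  domain := T.domain.comap V.symm.toLinearMap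
  toFun :=
    { toFun := fun f => V (T ⟨V.symm f.1, f.2⟩)
      map_add' := fun f g => by
        rw [← V.map_add, ← T.map_add]
        congr 2
        ext
        exact V.symm.map_add _ _
      map_smul' := fun c f => by
        rw [RingHom.id_apply, ← V.map_smul, ← T.map_smul]
        congr 2
        ext
        exact V.symm.map_smul _ _ }

/-- The eigenspace `ker (T - μ)`. -/
def eigenspace (T : E →ₗ.[ℂ] E) (μ : ℂ) : Submodule ℂ E where
  carrier := {f | ∃ hf : f ∈ T.domain, T ⟨f, hf⟩ = μ • f}
  zero_mem' := ⟨T.domain.zero_mem, by rw [smul_zero]; exact T.map_zero⟩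
  add_mem' := by
    rintro f g ⟨hf, hf'⟩ ⟨hg, hg'⟩
    exact ⟨T.domain.add_mem hf hg, by
      rw [smul_add, ← hf', ← hg', ← T.map_add]; rfl⟩
  smul_mem' := by
    rintro c f ⟨hf, hf'⟩
    exact ⟨T.domain.smul_mem c hf, by
      rw [smul_comm, ← hf', ← T.map_smul]; rfl⟩

end Operators

section HilbertOperators

variable {E : Type*} [NormedAddCommGroup E] [InnerProductSpace ℂ E]

/-- The spectrum of an unbounded operator `T`: the set of all `z` for which `T - z` has no bounded
everywhere defined inverse. -/
def opSpectrum (T : E →ₗ.[ℂ] E) : Set ℂ :=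
  {z | ¬ ∃ R : E →L[ℂ] E,
    (∀ f : E, ∃ h : R f ∈ T.domain, T ⟨R f, h⟩ - z • R f = f) ∧
    (∀ f : T.domain, R (T f - z • (f : E)) = f)}

/-- The real points of the spectrum. For a self-adjoint operator this is the whole spectrum. -/
def realSpectrum (T : E →ₗ.[ℂ] E) : Set ℝ := {l | (l : ℂ) ∈ opSpectrum T}

/-- The orthogonal projection onto (the closure of) the eigenspace `ker (T - μ)`. The eigenspaces
of a closed operator are closed. -/
def eigenProj [CompleteSpace E] (T : E →ₗ.[ℂ] E) (μ : ℂ) : E →L[ℂ] E :=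
  (eigenspace T μ).topologicalClosure.starProjection

/-- `e^{-itT} f = ∑_μ e^{-itμ} P_μ f` for a self-adjoint operator `T` with pure point spectrum,
where `P_μ` is the projection onto `ker (T - μ)`. -/
def expNegI [CompleteSpace E] (T : E →ₗ.[ℂ] E) (t : ℝ) (f : E) : E :=
  ∑' μ : ℝ, Complex.exp (-(Complex.I * t * μ)) • eigenProj T μ f

/-- The direct sum `⨁ₖ Aₖ` of operators `Aₖ` acting in mutually orthogonal subspaces `Vₖ` of `E`,
each one given on `E` as `Bₖ = Aₖ Pₖ` with `Pₖ` the orthogonal projection onto `Vₖ`. Its domain is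
the natural one: all `f` with `Pₖ f ∈ D(Aₖ)` for every `k`, and `∑ₖ Aₖ Pₖ f` convergent in `E` (for
mutually orthogonal summands this says `∑ₖ ‖Aₖ Pₖ f‖² < ∞`). -/
def directSumOp {ι : Type*} (B : ι → E →ₗ.[ℂ] E) : E →ₗ.[ℂ] E where
  domain :=
    { carrier := {f | ∃ h : ∀ k, f ∈ (B k).domain, Summable fun k => B k ⟨f, h k⟩}
      zero_mem' := ⟨fun k => (B k).domain.zero_mem, by
        have : (fun k => B k ⟨0, (B k).domain.zero_mem⟩) = fun _ => (0 : E) := by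
          funext k; exact (B k).map_zero
        rw [this]; exact summable_zero⟩
      add_mem' := by
        rintro f g ⟨hf, hf'⟩ ⟨hg, hg'⟩
        refine ⟨fun k => (B k).domain.add_mem (hf k) (hg k), (hf'.add hg').congr fun k => ?_⟩
        rw [← (B k).map_add]; rfl
      smul_mem' := by
        rintro c f ⟨hf, hf'⟩
        refine ⟨fun k => (B k).domain.smul_mem c (hf k), (hf'.const_smul c).congr fun k => ?_⟩
        rw [← (B k).map_smul]; rfl }
  toFun :=
    { toFun := fun f => ∑' k, B k ⟨f.1, f.2.1 k⟩
      map_add' := fun f g => by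
        rw [← f.2.2.tsum_add g.2.2]
        refine tsum_congr fun k => ?_
        rw [← (B k).map_add]; rfl
      map_smul' := fun c f => by
        rw [RingHom.id_apply, ← f.2.2.tsum_const_smul c]
        refine tsum_congr fun k => ?_
        rw [← (B k).map_smul]; rfl }

end HilbertOperators

/-! ### Annihilation and creation operators in `L²(ℝ)` -/

/-- `L²(ℝ)`. -/
abbrev L2 : Type := Lp ℂ 2 (volume : Measure ℝ)

/-- The graph of the weak derivative: `g` is the weak derivative of `f` when
`(φ', f) = -(φ, g)` for all Schwartz functions `φ`. -/
def derivGraph : Submodule ℂ (L2 × L2) where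
  carrier := {p | ∀ φ : 𝓢(ℝ, ℂ),
    inner ℂ ((SchwartzMap.derivCLM ℂ ℂ φ).toLp 2) p.1 = -inner ℂ (φ.toLp 2) p.2}
  zero_mem' := fun φ => by simp
  add_mem' := by
    intro p q hp hq φ
    rw [Prod.fst_add, Prod.snd_add, inner_add_right, inner_add_right, hp φ, hq φ, neg_add]
  smul_mem' := by
    intro c p hp φ
    rw [Prod.smul_fst, Prod.smul_snd, inner_smul_right, inner_smul_right, hp φ, mul_neg]

/-- `d/dx` in `L²(ℝ)`, on its maximal domain. -/
def ddx : L2 →ₗ.[ℂ] L2 := derivGraph.toLinearPMap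

/-- The graph of the multiplication by `x`. -/
def mulGraph : Submodule ℂ (L2 × L2) where
  carrier := {p | p.2 =ᵐ[volume] fun x : ℝ => (x : ℂ) * p.1 x}
  zero_mem' := by
    filter_upwards [Lp.coeFn_zero ℂ 2 (volume : Measure ℝ)] with x hx
    simp only [Prod.fst_zero, Prod.snd_zero, hx, Pi.zero_apply, mul_zero]
  add_mem' := by
    intro p q hp hq
    filter_upwards [hp, hq, Lp.coeFn_add p.1 q.1, Lp.coeFn_add p.2 q.2] with x h1 h2 h3 h4
    rw [Prod.fst_add, Prod.snd_add, h3, h4, Pi.add_apply, Pi.add_apply, h1, h2, mul_add]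
  smul_mem' := by
    intro c p hp
    filter_upwards [hp, Lp.coeFn_smul c p.1, Lp.coeFn_smul c p.2] with x h1 h3 h4
    rw [Prod.smul_fst, Prod.smul_snd, h3, h4, Pi.smul_apply, Pi.smul_apply, h1, smul_eq_mul,
      smul_eq_mul, mul_left_comm]

/-- Multiplication by `x` in `L²(ℝ)`, on its maximal domain. -/
def mulX : L2 →ₗ.[ℂ] L2 := mulGraph.toLinearPMap

/-- The identity operator. -/
def one : L2 →ₗ.[ℂ] L2 := LinearMap.id.toPMap ⊤

/-- The annihilation operator `a = (d/dx + x) / √2`. -/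
def ann : L2 →ₗ.[ℂ] L2 := (1 / (√2 : ℝ) : ℂ) • (ddx + mulX)

/-- The creation operator `a* = (-d/dx + x) / √2`. -/
def cre : L2 →ₗ.[ℂ] L2 := (1 / (√2 : ℝ) : ℂ) • (-ddx + mulX)

/-- The number operator `a* a`. -/
def num : L2 →ₗ.[ℂ] L2 := opMul cre ann

/-! ### Operators in `ℂ² ⊗ L²(ℝ)` -/

/-- The Hilbert space `ℂ² ⊗ L²(ℝ) = L²(ℝ) ⊕ L²(ℝ)`. -/
abbrev H : Type := PiLp 2 fun _ : Fin 2 => L2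

/-- `M ⊗ T` for an unbounded operator `T`, with domain `ℂ² ⊗ D(T)`. -/
def tensor (M : Matrix (Fin 2) (Fin 2) ℂ) (T : L2 →ₗ.[ℂ] L2) : H →ₗ.[ℂ] H where
  domain :=
    { carrier := {f | ∀ j, f j ∈ T.domain}
      zero_mem' := fun _ => T.domain.zero_mem
      add_mem' := fun hf hg j => T.domain.add_mem (hf j) (hg j)
      smul_mem' := fun c _ hf j => T.domain.smul_mem c (hf j) }
  toFun :=
    { toFun := fun f => WithLp.toLp 2 fun i => ∑ j, M i j • T ⟨f.1 j, f.2 j⟩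
      map_add' := fun f g => by
        ext1 i
        simp only [PiLp.add_apply, ← Finset.sum_add_distrib, ← smul_add, ← T.map_add]
        rfl
      map_smul' := fun c f => by
        ext1 i
        simp only [PiLp.smul_apply, Finset.smul_sum, RingHom.id_apply, smul_comm c, ← T.map_smul]
        rfl }

/-- `M ⊗ B` for an everywhere defined map `B`. -/
def tensorFun (M : Matrix (Fin 2) (Fin 2) ℂ) (B : L2 → L2) (f : H) : H :=
  WithLp.toLp 2 fun i => ∑ j, M i j • B (f j)

/-- The Pauli matrix `σ_x`. -/
def sigmaX : Matrix (Fin 2) (Fin 2) ℂ := !![0, 1; 1, 0]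

/-- The Pauli matrix `σ_z`. -/
def sigmaZ : Matrix (Fin 2) (Fin 2) ℂ := !![1, 0; 0, -1]

/-- The matrix `J = -i σ_y`. -/
def matJ : Matrix (Fin 2) (Fin 2) ℂ := !![0, -1; 1, 0]

/-- The one-particle non-commutative harmonic oscillator
`diag(α, β) ⊗ (a* a + 1/2) + (1/2) J ⊗ (a - a*)`. -/
def onePNcHO (α β : ℝ) : H →ₗ.[ℂ] H :=
  tensor !![(α : ℂ), 0; 0, (β : ℂ)] (num + (1 / 2 : ℂ) • one) +
    (1 / 2 : ℂ) • tensor matJ (ann - cre)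

/-- The one-photon quantum Rabi Hamiltonian
`Δ σ_z ⊗ 1 + 1 ⊗ (a* a + 1/2) + g σ_x ⊗ (a + a*)`. -/
def onePRabi (Δ g : ℝ) : H →ₗ.[ℂ] H :=
  (Δ : ℂ) • tensor sigmaZ one + tensor 1 (num + (1 / 2 : ℂ) • one) +
    (g : ℂ) • tensor sigmaX (ann + cre)

/-- The Rabi Hamiltonian with the parameters `Δ = (α - β) l / (2 α β)`, `g = 1 / (2 √(α β))`. -/
def onePRabiAt (α β l : ℝ) : H →ₗ.[ℂ] H :=
  onePRabi ((α - β) / (2 * α * β) * l) (1 / (2 * √(α * β)))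

/-! ### The Hilbert space with the weighted inner product -/

/-- The vector space `H` to be endowed with the inner product `(f, γ g)`, where
`γ = diag(1/α, 1/β) ⊗ 1`. -/
def HW (α β : ℝ) (_ : 0 < α) (_ : 0 < β) : Type := H

/-- The matrix `diag(1/α, 1/β)`. -/
def gammaMat (α β : ℝ) : Matrix (Fin 2) (Fin 2) ℂ := !![(1 / α : ℂ), 0; 0, (1 / β : ℂ)]

section Weighted

variable (α β : ℝ) (hα : 0 < α) (hβ : 0 < β)

instance : AddCommGroup (HW α β hα hβ) := inferInstanceAs (AddCommGroup H)

instance : Module ℂ (HW α β hα hβ) := inferInstanceAs (Module ℂ H)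

/-- The identity map. -/
def toHW : H ≃ₗ[ℂ] HW α β hα hβ := LinearEquiv.refl ℂ H

theorem inner_gamma (f g : H) :
    inner ℂ f (tensorFun (gammaMat α β) id g) =
      (1 / α : ℂ) * inner ℂ (f 0) (g 0) + (1 / β : ℂ) * inner ℂ (f 1) (g 1) := by
  simp [PiLp.inner_apply, tensorFun, gammaMat, Fin.sum_univ_two, inner_smul_right]

/-- The inner product `(f, g)_{αβ} = (f, γ g)`. -/
@[reducible]
def coreHW : InnerProductSpace.Core ℂ (HW α β hα hβ) where
  inner f g := inner ℂ ((toHW α β hα hβ).symm f)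
    (tensorFun (gammaMat α β) id ((toHW α β hα hβ).symm g))
  conj_inner_symm f g := by
    simp only [inner_gamma, map_add, map_mul, inner_conj_symm, map_div₀, map_one,
      Complex.conj_ofReal]
  re_inner_nonneg f := by
    simp only [inner_gamma, inner_self_eq_norm_sq_to_K]
    norm_cast
    simp only [RCLike.re_to_complex, Complex.coe_algebraMap]
    norm_cast
    positivity
  add_left f g h := by
    rw [map_add, inner_add_left]
  smul_left f g r := by
    rw [map_smul, inner_smul_left]
  definite f h := by
    simp only [inner_gamma, inner_self_eq_norm_sq_to_K] at h
    simp only [Complex.coe_algebraMap] at h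
    norm_cast at h
    have h0 : 0 ≤ 1 / α * ‖(toHW α β hα hβ).symm f 0‖ ^ 2 := by positivity
    have h1 : 0 ≤ 1 / β * ‖(toHW α β hα hβ).symm f 1‖ ^ 2 := by positivity
    have h0' : 1 / α * ‖(toHW α β hα hβ).symm f 0‖ ^ 2 = 0 := by linarith
    have h1' : 1 / β * ‖(toHW α β hα hβ).symm f 1‖ ^ 2 = 0 := by linarith
    have e0 : (toHW α β hα hβ).symm f 0 = 0 := by simpa [hα.ne'] using h0'
    have e1 : (toHW α β hα hβ).symm f 1 = 0 := by simpa [hβ.ne'] using h1'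
    apply (toHW α β hα hβ).symm.injective
    rw [map_zero]
    ext1 i
    fin_cases i
    · exact e0
    · exact e1

instance : NormedAddCommGroup (HW α β hα hβ) := (coreHW α β hα hβ).toNormedAddCommGroup

instance : InnerProductSpace ℂ (HW α β hα hβ) :=
  InnerProductSpace.ofCore (coreHW α β hα hβ).toCore

theorem inner_HW (f g : HW α β hα hβ) :
    inner ℂ f g = inner ℂ ((toHW α β hα hβ).symm f)
      (tensorFun (gammaMat α β) id ((toHW α β hα hβ).symm g)) := rfl

theorem norm_sq_HW (f : HW α β hα hβ) :
    ‖f‖ ^ 2 = 1 / α * ‖(toHW α β hα hβ).symm f 0‖ ^ 2 +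
      1 / β * ‖(toHW α β hα hβ).symm f 1‖ ^ 2 := by
  have h := inner_self_eq_norm_sq_to_K (𝕜 := ℂ) f
  rw [inner_HW, inner_gamma] at h
  simp only [inner_self_eq_norm_sq_to_K, Complex.coe_algebraMap] at h
  exact_mod_cast h.symm

/-- The isometry `γ^{1/2}` onto `H`; it shows that the weighted space is complete. -/
def sqrtGamma : HW α β hα hβ ≃ₗᵢ[ℂ] H where
  toFun f := WithLp.toLp 2 ![(1 / √α : ℂ) • (toHW α β hα hβ).symm f 0,
    (1 / √β : ℂ) • (toHW α β hα hβ).symm f 1]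
  invFun f := toHW α β hα hβ (WithLp.toLp 2 ![(√α : ℂ) • f 0, (√β : ℂ) • f 1])
  map_add' f g := by
    ext1 i
    fin_cases i <;> simp
  map_smul' c f := by
    ext1 i
    fin_cases i <;> simp [smul_comm c]
  left_inv f := by
    have hα' : (√α : ℂ) ≠ 0 := by exact_mod_cast (Real.sqrt_pos.2 hα).ne'
    have hβ' : (√β : ℂ) ≠ 0 := by exact_mod_cast (Real.sqrt_pos.2 hβ).ne'
    apply (toHW α β hα hβ).symm.injective
    ext1 i
    fin_cases i <;> simp [smul_smul, hα', hβ']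
  right_inv f := by
    have hα' : (√α : ℂ) ≠ 0 := by exact_mod_cast (Real.sqrt_pos.2 hα).ne'
    have hβ' : (√β : ℂ) ≠ 0 := by exact_mod_cast (Real.sqrt_pos.2 hβ).ne'
    ext1 i
    fin_cases i
    · change (1 / √α : ℂ) • (√α : ℂ) • f 0 = f 0
      rw [smul_smul, one_div_mul_cancel hα', one_smul]
    · change (1 / √β : ℂ) • (√β : ℂ) • f 1 = f 1
      rw [smul_smul, one_div_mul_cancel hβ', one_smul]
  norm_map' f := by
    rw [← sq_eq_sq₀ (norm_nonneg _) (norm_nonneg _), norm_sq_HW, PiLp.norm_sq_eq_of_L2]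
    simp [Fin.sum_univ_two, norm_smul, mul_pow, abs_of_nonneg, Real.sqrt_nonneg, hα.le, hβ.le]

instance : CompleteSpace (HW α β hα hβ) :=
  (sqrtGamma α β hα hβ).toIsometryEquiv.completeSpace

/-- The matrix `c = diag(√α, √β) e^{i (π/4) σ_z}`. -/
def matC : Matrix (Fin 2) (Fin 2) ℂ :=
  !![(√α : ℂ), 0; 0, (√β : ℂ)] * NormedSpace.exp ((Complex.I * (Real.pi / 4)) • sigmaZ)

/-- The map `c ⊗ e^{-i (π/2) a* a}` from `H` to the weighted space. -/
def tildeI (f : H) : HW α β hα hβ :=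
  toHW α β hα hβ (tensorFun (matC α β) (expNegI num (Real.pi / 2)) f)

/-- The Rabi Hamiltonian `onePRabiAt`, regarded as an operator in the weighted space. -/
def rabiHW (l : ℝ) : HW α β hα hβ →ₗ.[ℂ] HW α β hα hβ :=
  conj (toHW α β hα hβ) (onePRabiAt α β l)

/-- The fibre space: the eigenspace of the Rabi Hamiltonian with parameter `l` for the eigenvalue
`(α + β) l / (2 α β)`, as a closed subspace of the weighted space. -/
def fiberSpace (l : ℝ) : Submodule ℂ (HW α β hα hβ) :=
  (eigenspace (rabiHW α β hα hβ l) ((α + β) / (2 * α * β) * l : ℝ)).topologicalClosure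

/-- The fibre: the Rabi Hamiltonian with parameter `l`, times the orthogonal projection of the
weighted space onto the eigenspace for the eigenvalue `(α + β) l / (2 α β)`. -/
def fiberOp (l : ℝ) : HW α β hα hβ →ₗ.[ℂ] HW α β hα hβ :=
  opMul (rabiHW α β hα hβ l)
    ((eigenProj (rabiHW α β hα hβ l) ((α + β) / (2 * α * β) * l : ℝ)).toLinearMap.toPMap ⊤)

end Weighted

end NcHO

end

-- Let `V` be `weightedEquiv`, that is `c ⊗ e^{-i(π/2)a*a}`, write `Q` for the oscillator and put
-- `μ(l) = (α+β)l/(2αβ)`. The number operator commutes with the phases `(-i)^n`, and the additional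
-- phases `e^{±iπ/4}` turn `a - a*` into `±(a + a*)`. Dividing the two rows of `(Q - l)f = 0` by `α`
-- and `β` leaves the constants `-l/α = Δ - μ(l)` and `-l/β = -Δ - μ(l)`. Hence `(H(l) - μ(l)) V f`
-- is, up to an invertible factor in each component, the image of `(Q - l) f` under a unitary. So
-- `V` maps `ker (Q - l)` onto the fibre `ker (H(l) - μ(l))` (`eigenspace_rabiHW`). The parameter
-- `l` enters both the operator and the eigenvalue, so `H(l)` is matched with `Q` on one eigenspace
-- only.
--
-- It remains to diagonalise `Q`. It is symmetric, and `Q + K` has a compact inverse for large `K`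
-- (`exists_onePNcHO_resolvent`): the diagonal part is inverted in the Hermite basis and the
-- off-diagonal part is absorbed by a Neumann series. The spectral theorem for compact symmetric
-- operators then makes the space the Hilbert sum of the eigenspaces and gives `V Q V⁻¹ = ∑ l P_l`
-- on the maximal domain (`hasSum_apply`, `mem_domain_of_summable`). On the fibre, `H(l)` is the
-- scalar `μ(l)`, and the prefactor `2αβ/(α+β)` turns `μ(l)` back into `l`.
--
-- The operators `d/dx` and `x` are given by maximal weak definitions, so the Hermite functions must
-- be shown to be complete (`eq_zero_of_inner_hermiteFun`) and the domains of `a`, `a*` and `a*a`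
-- described by Hermite coefficients (`mem_domain_ann_iff`, `mem_domain_num_iff`). After that every
-- computation is one on sequences.

noncomputable section

namespace NcHO

-- Spectral decomposition of an operator with compact symmetric resolvent

section CompactResolvent

variable {E : Type*} [NormedAddCommGroup E] [InnerProductSpace ℂ E]

theorem mem_opSpectrum {T : E →ₗ.[ℂ] E} {z : ℂ} {f : E} (hf : f ∈ eigenspace T z) (h0 : f ≠ 0) :
    z ∈ opSpectrum T := by
  rintro ⟨S, -, hS⟩
  obtain ⟨h1, h2⟩ := hf
  have := hS ⟨f, h1⟩
  rw [h2] at this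
  simp only [sub_self, map_zero] at this
  exact h0 this.symm

theorem eigenProj_of_mem [CompleteSpace E] {T : E →ₗ.[ℂ] E} {z : ℂ} {f : E}
    (hf : f ∈ eigenspace T z) : eigenProj T z f = f :=
  Submodule.starProjection_eq_self_iff.2 (Submodule.le_topologicalClosure _ hf)

/-- `R` is a compact symmetric inverse of `T + K`. -/
structure HasCompactResolvent (T : E →ₗ.[ℂ] E) (R : E →L[ℂ] E) (K : ℝ) : Prop where
  right_inv : ∀ f : E, ∃ h : R f ∈ T.domain, T ⟨R f, h⟩ + (K : ℂ) • R f = f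
  left_inv : ∀ f : T.domain, R (T f + (K : ℂ) • (f : E)) = f
  compact : IsCompactOperator R
  symm : ∀ f g : E, inner ℂ (R f) g = inner ℂ f (R g)

namespace HasCompactResolvent

variable {T : E →ₗ.[ℂ] E} {R : E →L[ℂ] E} {K : ℝ}

/-- The right-hand side involves only the bounded operator `R`: the domain condition disappears
because a multiple of `R f` lies in the range of `R`. Closedness and orthogonality of eigenspaces
are read off from this form. -/
theorem mem_eigenspace_iff (h : HasCompactResolvent T R K) {z : ℂ} {f : E} :
    f ∈ eigenspace T z ↔ (z + K) • R f = f := by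
  constructor
  · rintro ⟨hf, hf'⟩
    have := h.left_inv ⟨f, hf⟩
    rw [hf'] at this
    simpa [add_smul] using this
  · intro hf
    obtain ⟨h1, h2⟩ := h.right_inv f
    have hmem : f ∈ T.domain := by
      rw [← hf]; exact T.domain.smul_mem _ h1
    refine ⟨hmem, ?_⟩
    have e : (⟨f, hmem⟩ : T.domain) = (z + K) • ⟨R f, h1⟩ := Subtype.ext hf.symm
    rw [e, T.map_smul]
    have h3 : T ⟨R f, h1⟩ = f - (K : ℂ) • R f := eq_sub_of_add_eq h2
    rw [h3, smul_sub, smul_comm, hf, ← sub_smul]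
    simp

theorem isClosed_eigenspace (h : HasCompactResolvent T R K) (z : ℂ) :
    IsClosed (eigenspace T z : Set E) := by
  have : (eigenspace T z : Set E) = {f | (z + K) • R f = f} := by
    ext f; exact h.mem_eigenspace_iff
  rw [this]
  exact isClosed_eq (by fun_prop) continuous_id

theorem topologicalClosure_eigenspace (h : HasCompactResolvent T R K) (z : ℂ) :
    (eigenspace T z).topologicalClosure = eigenspace T z :=
  (h.isClosed_eigenspace z).submodule_topologicalClosure_eq

theorem inner_eq_zero (h : HasCompactResolvent T R K) {l m : ℝ} (hlm : l ≠ m)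
    {f g : E} (hf : f ∈ eigenspace T l)
    (hg : g ∈ eigenspace T m) : inner ℂ f g = 0 := by
  rw [h.mem_eigenspace_iff] at hf hg
  have h1 : (inner ℂ f g : ℂ) = (l + K) * inner ℂ (R f) g := by
    conv_lhs => rw [← hf]
    rw [inner_smul_left]; simp
  have h2 : (inner ℂ f g : ℂ) = (m + K) * inner ℂ (R f) g := by
    conv_lhs => rw [← hg]
    rw [inner_smul_right, h.symm]
  have h3 : ((l : ℂ) - m) * inner ℂ (R f) g = 0 := by linear_combination h2 - h1
  have h4 : (l : ℂ) - m ≠ 0 := by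
    rw [sub_ne_zero]; exact_mod_cast hlm
  rw [h1, (mul_eq_zero.1 h3).resolve_left h4, mul_zero]

theorem injective (h : HasCompactResolvent T R K) : Function.Injective R := by
  rw [injective_iff_map_eq_zero]
  intro f hf
  obtain ⟨h1, h2⟩ := h.right_inv f
  have e : (⟨R f, h1⟩ : T.domain) = 0 := Subtype.ext hf
  rw [e, T.map_zero, hf] at h2
  simpa using h2.symm

variable [CompleteSpace E] {S : Set ℝ}

/-- An eigenvalue `μ` of `R` is nonzero by injectivity and real by symmetry, and it corresponds to
the eigenvalue `μ⁻¹ - K` of `T`; so the eigenspaces of `T` contain all those of `R`, which span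
densely. The index set `S` only has to contain the eigenvalues, as any other index contributes the
zero space. The family `F` is left free so that the Rabi fibres can be inserted for the eigenspaces.
-/
theorem isHilbertSum (h : HasCompactResolvent T R K)
    (hS : ∀ l : ℝ, ∀ f ∈ eigenspace T l, f ≠ 0 → l ∈ S) (F : S → Submodule ℂ E)
    (hF : ∀ l, F l = eigenspace T (l : ℝ)) :
    IsHilbertSum ℂ (fun l => F l) (fun l => (F l).subtypeₗᵢ) := by
  have hcl : ∀ l, IsClosed (F l : Set E) := fun l => by
    rw [hF]; exact h.isClosed_eigenspace _
  have : ∀ l, CompleteSpace (F l) := fun l => (hcl l).completeSpace_coe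
  refine IsHilbertSum.mkInternal F ?_ ?_
  · intro l m hlm f g
    have hf : (f : E) ∈ eigenspace T (l : ℝ) := hF l ▸ f.2
    have hg : (g : E) ∈ eigenspace T (m : ℝ) := hF m ▸ g.2
    exact h.inner_eq_zero (fun e => hlm (Subtype.ext e)) hf hg
  · have hs : (R : E →ₗ[ℂ] E).IsSymmetric := h.symm
    have key := ContinuousLinearMap.orthogonalComplement_iSup_eigenspaces_eq_bot h.compact hs
    rw [top_le_iff, Submodule.topologicalClosure_eq_top_iff, eq_bot_iff, ← key]
    refine Submodule.orthogonal_le (iSup_le fun μ => ?_)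
    intro f hf
    by_cases h0 : f = 0
    · rw [h0]; exact Submodule.zero_mem _
    have hf' : R f = μ • f := Module.End.mem_eigenspace_iff.1 hf
    have hμ : μ ≠ 0 := by
      rintro rfl
      rw [zero_smul] at hf'
      exact h0 (h.injective (by rw [hf', map_zero]))
    have hreal : (starRingEnd ℂ) μ = μ :=
      hs.conj_eigenvalue_eq_self (Module.End.hasEigenvalue_of_hasEigenvector ⟨hf, h0⟩)
    obtain ⟨r, rfl⟩ := Complex.conj_eq_iff_real.1 hreal
    have hmem : f ∈ eigenspace T ((r⁻¹ - K : ℝ) : ℂ) := by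
      rw [h.mem_eigenspace_iff, hf', smul_smul]
      have : ((r⁻¹ - K : ℝ) + K : ℂ) * r = 1 := by
        push_cast; field_simp; ring
      rw [this, one_smul]
    have hsp : (r⁻¹ - K : ℝ) ∈ S := hS _ f hmem h0
    refine Submodule.mem_iSup_of_mem (⟨_, hsp⟩ : S) ?_
    rw [hF]; exact hmem

theorem eigenProj_mem (h : HasCompactResolvent T R K) (z : ℂ) (f : E) :
    eigenProj T z f ∈ eigenspace T z := by
  have := Submodule.starProjection_apply_mem (eigenspace T z).topologicalClosure f
  exact h.topologicalClosure_eigenspace z ▸ this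

theorem eigenProj_of_mem_of_ne (h : HasCompactResolvent T R K) {l m : ℝ} (hlm : l ≠ m)
    {f : E} (hf : f ∈ eigenspace T l) :
    eigenProj T m f = 0 := by
  refine (Submodule.starProjection_apply_eq_zero_iff _).2 ?_
  rw [h.topologicalClosure_eigenspace]
  intro g hg
  exact h.inner_eq_zero hlm.symm hg hf

theorem hasSum_eigenProj (h : HasCompactResolvent T R K)
    (hS : ∀ l : ℝ, ∀ f ∈ eigenspace T l, f ≠ 0 → l ∈ S) (f : E) :
    HasSum (fun l : S => eigenProj T (l : ℝ) f) f := by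
  have hsum := h.isHilbertSum hS (fun l => eigenspace T (l : ℝ)) (fun _ => rfl)
  obtain ⟨w, rfl⟩ := hsum.surjective_isometry f
  have hw := hsum.OrthogonalFamily.hasSum_linearIsometry w
  convert hw using 1
  funext l
  have h1 := ((eigenProj T (l : ℝ)).hasSum hw)
  refine h1.unique ?_
  convert hasSum_single l ?_ using 1
  · exact (eigenProj_of_mem (w l).2).symm
  · intro m hm
    exact h.eigenProj_of_mem_of_ne (fun e => hm (Subtype.ext e)) (w m).2

/-- `R` preserves every eigenspace, so in the expansion of `R g` the projection for `l` keeps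
exactly one term. -/
theorem eigenProj_comm (h : HasCompactResolvent T R K)
    (hS : ∀ l : ℝ, ∀ f ∈ eigenspace T l, f ≠ 0 → l ∈ S) (l : S) (g : E) :
    eigenProj T (l : ℝ) (R g) = R (eigenProj T (l : ℝ) g) := by
  have hR : ∀ m : ℝ, R (eigenProj T m g) ∈ eigenspace T m := fun m => by
    have := h.eigenProj_mem m g
    rw [h.mem_eigenspace_iff] at this ⊢
    rw [← R.map_smul, this]
  have h1 := (eigenProj T (l : ℝ)).hasSum (R.hasSum (h.hasSum_eigenProj hS g))
  refine h1.unique ?_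
  convert hasSum_single l ?_ using 1
  · exact (eigenProj_of_mem (hR l)).symm
  · intro m hm
    exact h.eigenProj_of_mem_of_ne (fun e => hm (Subtype.ext e)) (hR m)

/-- An unbounded `T` cannot be applied termwise. Instead `(T + K) f` and `K f` are expanded and
subtracted; the coefficients are identified through `f = R (T + K) f`, since `R` commutes with the
projections. -/
theorem hasSum_apply (h : HasCompactResolvent T R K)
    (hS : ∀ l : ℝ, ∀ f ∈ eigenspace T l, f ≠ 0 → l ∈ S) (f : T.domain) :
    HasSum (fun l : S => ((l : ℝ) : ℂ) • eigenProj T (l : ℝ) f) (T f) := by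
  have h1 := h.hasSum_eigenProj hS (T f + (K : ℂ) • (f : E))
  have h2 := (h.hasSum_eigenProj hS (f : E)).const_smul (K : ℂ)
  have h3 := h1.sub h2
  rw [add_sub_cancel_right] at h3
  refine h3.congr_fun ?_
  intro l
  have h4 := h.eigenProj_comm hS l (T f + (K : ℂ) • (f : E))
  rw [h.left_inv] at h4
  have h5 := h.mem_eigenspace_iff.1 (h.eigenProj_mem (l : ℝ) (T f + (K : ℂ) • (f : E)))
  rw [← h4] at h5
  rw [← h5]
  simp [add_smul]

/-- If `g` is the sum of the series, comparing expansions gives `R (g + K f) = f`, and the range of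
`R` lies in the domain. This is why the domain of `T` is the maximal one. -/
theorem mem_domain_of_summable (h : HasCompactResolvent T R K)
    (hS : ∀ l : ℝ, ∀ f ∈ eigenspace T l, f ≠ 0 → l ∈ S) {f : E}
    (hf : Summable fun l : S => ((l : ℝ) : ℂ) • eigenProj T (l : ℝ) f) :
    f ∈ T.domain := by
  obtain ⟨g, hg⟩ := hf
  have h1 := R.hasSum (hg.add ((h.hasSum_eigenProj hS f).const_smul (K : ℂ)))
  have h2 : R (g + (K : ℂ) • f) = f := by
    refine h1.unique ((h.hasSum_eigenProj hS f).congr_fun fun l => ?_)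
    have := h.mem_eigenspace_iff.1 (h.eigenProj_mem (l : ℝ) f)
    rw [← add_smul, R.map_smul, this]
  rw [← h2]
  exact (h.right_inv _).1

end HasCompactResolvent

end CompactResolvent

/-! ### The Hermite basis -/

section Hermite

theorem exists_bound_pow_mul_gaussian (k : ℕ) :
    ∃ C : ℝ, ∀ x : ℝ, |x| ^ k * Real.exp (-(x ^ 2 / 2)) ≤ C := by
  refine ⟨k.factorial * Real.exp (1 / 2), fun x => ?_⟩
  have h1 := Real.pow_div_factorial_le_exp |x| (abs_nonneg x) k
  rw [div_le_iff₀ (by positivity)] at h1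
  -- `|x| - x²/2 ≤ 1/2`, which is `(|x| - 1)² ≥ 0`.
  have h2 : Real.exp |x| * Real.exp (-(x ^ 2 / 2)) ≤ Real.exp (1 / 2) := by
    rw [← Real.exp_add, Real.exp_le_exp]
    nlinarith [sq_nonneg (|x| - 1), sq_abs x]
  have hk : (0 : ℝ) ≤ k.factorial := by positivity
  calc |x| ^ k * Real.exp (-(x ^ 2 / 2))
      ≤ (Real.exp |x| * k.factorial) * Real.exp (-(x ^ 2 / 2)) := by gcongr
    _ = k.factorial * (Real.exp |x| * Real.exp (-(x ^ 2 / 2))) := by ring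
    _ ≤ _ := by gcongr

theorem exists_bound_pow_mul_polynomial_mul_gaussian (p : Polynomial ℝ) (k : ℕ) :
    ∃ C : ℝ, ∀ x : ℝ, |x| ^ k * |p.eval x * Real.exp (-(x ^ 2 / 2))| ≤ C := by
  induction p using Polynomial.induction_on' with
  | add p q hp hq =>
    obtain ⟨C, hC⟩ := hp
    obtain ⟨D, hD⟩ := hq
    refine ⟨C + D, fun x => (le_trans ?_ (add_le_add (hC x) (hD x)))⟩
    rw [Polynomial.eval_add, add_mul, ← mul_add]
    exact mul_le_mul_of_nonneg_left (abs_add_le _ _) (by positivity)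
  | monomial n a =>
    obtain ⟨C, hC⟩ := exists_bound_pow_mul_gaussian (k + n)
    refine ⟨|a| * C, fun x => ?_⟩
    rw [Polynomial.eval_monomial, abs_mul, abs_mul, abs_pow, abs_of_pos (Real.exp_pos _)]
    calc |x| ^ k * (|a| * |x| ^ n * Real.exp (-(x ^ 2 / 2)))
        = |a| * (|x| ^ (k + n) * Real.exp (-(x ^ 2 / 2))) := by ring
      _ ≤ _ := by gcongr; exact hC x

/-- The function `e^{-x²/2}` as a real Schwartz function. -/
def gaussianReal : 𝓢(ℝ, ℝ) where
  toFun x := Real.exp (-(x ^ 2 / 2))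
  smooth' := by fun_prop
  decay' k n := by
    obtain ⟨C, hC⟩ := exists_bound_pow_mul_polynomial_mul_gaussian
      ((Polynomial.hermite n).map (algebraMap ℤ ℝ)) k
    refine ⟨C, fun x => ?_⟩
    rw [norm_iteratedFDeriv_eq_norm_iteratedDeriv, iteratedDeriv_eq_iterate,
      Polynomial.deriv_gaussian_eq_hermite_mul_gaussian, Real.norm_eq_abs, Real.norm_eq_abs]
    convert hC x using 2
    rw [Polynomial.aeval_def, Polynomial.eval_map, mul_assoc, abs_mul]
    simp

/-- The function `e^{-x²/2}` as a complex Schwartz function. -/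
def gaussian : 𝓢(ℝ, ℂ) := gaussianReal.postcompCLM Complex.ofRealCLM

theorem gaussian_apply (x : ℝ) : gaussian x = (Real.exp (-(x ^ 2 / 2)) : ℝ) := rfl

/-- Multiplication by `x` on Schwartz functions. -/
def schwartzX : 𝓢(ℝ, ℂ) →L[ℂ] 𝓢(ℝ, ℂ) := SchwartzMap.smulLeftCLM ℂ (fun x : ℝ => (x : ℂ))

@[simp]
theorem schwartzX_apply (φ : 𝓢(ℝ, ℂ)) (x : ℝ) : schwartzX φ x = x * φ x :=
  SchwartzMap.smulLeftCLM_apply_apply (by fun_prop) φ x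

/-- The annihilation operator on Schwartz functions. -/
def schwartzAnn : 𝓢(ℝ, ℂ) →L[ℂ] 𝓢(ℝ, ℂ) :=
  (1 / (√2 : ℝ) : ℂ) • (SchwartzMap.derivCLM ℂ ℂ + schwartzX)

/-- The creation operator on Schwartz functions. -/
def schwartzCre : 𝓢(ℝ, ℂ) →L[ℂ] 𝓢(ℝ, ℂ) :=
  (1 / (√2 : ℝ) : ℂ) • (-SchwartzMap.derivCLM ℂ ℂ + schwartzX)

theorem inv_sqrt_two_mul_self : (1 / (√2 : ℝ) : ℂ) * (1 / (√2 : ℝ) : ℂ) = 1 / 2 := by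
  rw [div_mul_div_comm, ← Complex.ofReal_mul, Real.mul_self_sqrt (by norm_num)]
  norm_num

theorem derivCLM_schwartzX (φ : 𝓢(ℝ, ℂ)) :
    SchwartzMap.derivCLM ℂ ℂ (schwartzX φ) = φ + schwartzX (SchwartzMap.derivCLM ℂ ℂ φ) := by
  ext x
  have h1 : HasDerivAt (fun y : ℝ => (y : ℂ) * φ y) (1 * φ x + x * deriv φ x) x :=
    (Complex.ofRealCLM.hasDerivAt (x := x)).mul (φ.hasDerivAt x)
  have h2 : (schwartzX φ : ℝ → ℂ) = fun y : ℝ => (y : ℂ) * φ y := by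
    funext y; exact schwartzX_apply φ y
  rw [SchwartzMap.derivCLM_apply, h2, h1.deriv, add_apply, schwartzX_apply,
    SchwartzMap.derivCLM_apply, one_mul]

/-- The canonical commutation relation, from which all ladder identities follow. -/
theorem schwartzAnn_schwartzCre (φ : 𝓢(ℝ, ℂ)) :
    schwartzAnn (schwartzCre φ) = schwartzCre (schwartzAnn φ) + φ := by
  simp only [schwartzAnn, schwartzCre, smul_apply,
    add_apply, neg_apply, map_smul, map_add, map_neg,
    derivCLM_schwartzX, smul_smul, inv_sqrt_two_mul_self, smul_add, smul_neg]
  module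

theorem schwartzAnn_gaussian : schwartzAnn gaussian = 0 := by
  have : SchwartzMap.derivCLM ℂ ℂ gaussian = -schwartzX gaussian := by
    ext x
    have h1 : HasDerivAt (fun y : ℝ => Real.exp (-(y ^ 2 / 2)))
        (-(x * Real.exp (-(x ^ 2 / 2)))) x := by
      have h := (((hasDerivAt_pow 2 x).div_const 2).fun_neg).exp
      convert h using 1
      push_cast; ring
    have h2 := h1.ofReal_comp
    rw [SchwartzMap.derivCLM_apply, neg_apply, schwartzX_apply]
    refine (h2.deriv).trans ?_
    rw [gaussian_apply]; push_cast; rfl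
  simp [schwartzAnn, this]

theorem integral_inner_derivCLM (φ ψ : 𝓢(ℝ, ℂ)) :
    inner ℂ ((SchwartzMap.derivCLM ℂ ℂ φ).toLp 2) (ψ.toLp 2 : L2) =
      -inner ℂ (φ.toLp 2 : L2) ((SchwartzMap.derivCLM ℂ ℂ ψ).toLp 2) := by
  rw [SchwartzMap.inner_toL2_toL2_eq _ _ volume, SchwartzMap.inner_toL2_toL2_eq _ _ volume]
  have := SchwartzMap.integral_bilinear_deriv_right_eq_neg_left φ ψ
    ((ContinuousLinearMap.mul ℝ ℂ).comp (Complex.conjCLE : ℂ →L[ℝ] ℂ))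
  rw [eq_neg_iff_add_eq_zero, add_comm, ← eq_neg_iff_add_eq_zero]
  simpa [mul_comm] using this

theorem integral_inner_schwartzX (φ ψ : 𝓢(ℝ, ℂ)) :
    inner ℂ ((schwartzX φ).toLp 2) (ψ.toLp 2 : L2) =
      inner ℂ (φ.toLp 2 : L2) ((schwartzX ψ).toLp 2) := by
  rw [SchwartzMap.inner_toL2_toL2_eq _ _ volume, SchwartzMap.inner_toL2_toL2_eq _ _ volume]
  congr 1
  funext x
  simp only [schwartzX_apply, RCLike.inner_apply, map_mul, Complex.conj_ofReal]
  ring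

/-- The inclusion of the Schwartz functions in `L²(ℝ)`. -/
def toL2 : 𝓢(ℝ, ℂ) →L[ℂ] L2 := SchwartzMap.toLpCLM ℂ ℂ 2 volume

theorem toL2_apply (φ : 𝓢(ℝ, ℂ)) : toL2 φ = φ.toLp 2 := rfl

theorem inner_schwartzCre_left (φ ψ : 𝓢(ℝ, ℂ)) :
    inner ℂ (toL2 (schwartzCre φ)) (toL2 ψ) = inner ℂ (toL2 φ) (toL2 (schwartzAnn ψ)) := by
  simp only [schwartzAnn, schwartzCre, smul_apply,
    add_apply, neg_apply, map_smul, map_add, map_neg,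
    inner_smul_left, inner_smul_right, inner_add_left, inner_add_right, inner_neg_left, toL2_apply,
    integral_inner_derivCLM, integral_inner_schwartzX]
  simp

theorem inner_schwartzAnn_left (φ ψ : 𝓢(ℝ, ℂ)) :
    inner ℂ (toL2 (schwartzAnn φ)) (toL2 ψ) = inner ℂ (toL2 φ) (toL2 (schwartzCre ψ)) := by
  rw [← inner_conj_symm, ← inner_schwartzCre_left, inner_conj_symm]

/-- The Hermite functions. -/
def hermiteFun : ℕ → 𝓢(ℝ, ℂ)
  | 0 => (1 / ‖toL2 gaussian‖ : ℂ) • gaussian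
  | n + 1 => (1 / (√(n + 1 : ℝ) : ℝ) : ℂ) • schwartzCre (hermiteFun n)

theorem schwartzCre_hermiteFun (n : ℕ) :
    schwartzCre (hermiteFun n) = ((√(n + 1 : ℝ) : ℝ) : ℂ) • hermiteFun (n + 1) := by
  have : ((√(n + 1 : ℝ) : ℝ) : ℂ) ≠ 0 := by
    have : √(n + 1 : ℝ) ≠ 0 := by positivity
    exact_mod_cast this
  rw [hermiteFun, smul_smul, mul_one_div_cancel this, one_smul]

theorem schwartzAnn_hermiteFun_zero : schwartzAnn (hermiteFun 0) = 0 := by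
  rw [hermiteFun, map_smul, schwartzAnn_gaussian, smul_zero]

theorem sqrt_mul_self_cast (n : ℕ) : ((√(n + 1 : ℝ) : ℝ) : ℂ) * (√(n + 1 : ℝ) : ℝ) = n + 1 := by
  rw [← Complex.ofReal_mul, Real.mul_self_sqrt (by positivity)]
  push_cast; rfl

theorem schwartzAnn_hermiteFun_succ (n : ℕ) :
    schwartzAnn (hermiteFun (n + 1)) = ((√(n + 1 : ℝ) : ℝ) : ℂ) • hermiteFun n := by
  have h0 : ((√(n + 1 : ℝ) : ℝ) : ℂ) ≠ 0 := by
    have : √(n + 1 : ℝ) ≠ 0 := by positivity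
    exact_mod_cast this
  -- `a a* = a* a + 1`, and `a* a h_n = n h_n` follows from the same theorem at the preceding index.
  have key : schwartzAnn (schwartzCre (hermiteFun n)) = (n + 1 : ℂ) • hermiteFun n := by
    rw [schwartzAnn_schwartzCre]
    cases n with
    | zero => simp [schwartzAnn_hermiteFun_zero]
    | succ n =>
      rw [schwartzAnn_hermiteFun_succ n, map_smul, schwartzCre_hermiteFun, smul_smul,
        sqrt_mul_self_cast]
      push_cast; module
  rw [hermiteFun, map_smul, key, ← sqrt_mul_self_cast, smul_smul, ← mul_assoc,
    one_div_mul_cancel h0, one_mul]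

theorem gaussian_ne_zero : toL2 gaussian ≠ 0 := by
  intro h
  have h1 : gaussian = 0 := SchwartzMap.injective_toLp 2 volume (by
    simpa [toL2_apply] using h.trans (map_zero toL2).symm)
  have h2 := congrArg (fun f : 𝓢(ℝ, ℂ) => f 0) h1
  simp [gaussian_apply] at h2

theorem inner_hermiteFun (n m : ℕ) :
    inner ℂ (toL2 (hermiteFun n)) (toL2 (hermiteFun m)) = if n = m then (1 : ℂ) else 0 := by
  induction n generalizing m with
  | zero =>
    cases m with
    | zero =>
      have : (‖toL2 gaussian‖ : ℂ) ≠ 0 := by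
        exact_mod_cast norm_ne_zero_iff.2 gaussian_ne_zero
      rw [hermiteFun, map_smul, inner_smul_left, inner_smul_right, inner_self_eq_norm_sq_to_K]
      simp
      field_simp
    | succ m =>
      rw [hermiteFun.eq_2, map_smul, inner_smul_right, ← inner_schwartzAnn_left,
        schwartzAnn_hermiteFun_zero]
      simp
  | succ n ih =>
    rw [hermiteFun.eq_2, map_smul, inner_smul_left, inner_schwartzCre_left]
    cases m with
    | zero => simp [schwartzAnn_hermiteFun_zero]
    | succ m =>
      rw [schwartzAnn_hermiteFun_succ, map_smul, inner_smul_right, ih]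
      by_cases hnm : n = m
      · subst hnm
        have h0 : ((√(n + 1 : ℝ) : ℝ) : ℂ) ≠ 0 := by
          have : √(n + 1 : ℝ) ≠ 0 := by positivity
          exact_mod_cast this
        simp [h0]
      · simp [hnm]

theorem orthonormal_hermiteFun : Orthonormal ℂ fun n => toL2 (hermiteFun n) :=
  orthonormal_iff_ite.2 inner_hermiteFun

theorem schwartzX_eq (φ : 𝓢(ℝ, ℂ)) :
    schwartzX φ = (1 / (√2 : ℝ) : ℂ) • (schwartzAnn φ + schwartzCre φ) := by
  simp only [schwartzAnn, schwartzCre, smul_apply,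
    add_apply, neg_apply, smul_add, smul_smul,
    inv_sqrt_two_mul_self, smul_neg]
  module

/-- Multiplication by `x` is `(a + a*)/√2`, so it preserves the span of the Hermite functions.
Orthogonality to all Hermite functions therefore kills all moments against the Gaussian. -/
theorem schwartzX_pow_gaussian_mem_span (n : ℕ) :
    (schwartzX ^ n) gaussian ∈ Submodule.span ℂ (Set.range hermiteFun) := by
  induction n with
  | zero =>
    have h0 : (‖toL2 gaussian‖ : ℂ) ≠ 0 := by
      exact_mod_cast norm_ne_zero_iff.2 gaussian_ne_zero
    have : gaussian = (‖toL2 gaussian‖ : ℂ) • hermiteFun 0 := by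
      rw [hermiteFun, smul_smul, mul_one_div_cancel h0, one_smul]
    rw [pow_zero, one_apply_eq_self, this]
    exact Submodule.smul_mem _ _ (Submodule.subset_span ⟨0, rfl⟩)
  | succ n ih =>
    rw [pow_succ', mul_apply_eq_comp]
    have hle : Submodule.span ℂ (Set.range hermiteFun) ≤
        (Submodule.span ℂ (Set.range hermiteFun)).comap (schwartzX : 𝓢(ℝ, ℂ) →ₗ[ℂ] 𝓢(ℝ, ℂ)) := by
      rw [Submodule.span_le]
      rintro _ ⟨m, rfl⟩
      change schwartzX (hermiteFun m) ∈ Submodule.span ℂ (Set.range hermiteFun)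
      rw [schwartzX_eq, schwartzCre_hermiteFun]
      refine Submodule.smul_mem _ _ (Submodule.add_mem _ ?_
        (Submodule.smul_mem _ _ (Submodule.subset_span ⟨_, rfl⟩)))
      cases m with
      | zero => rw [schwartzAnn_hermiteFun_zero]; exact Submodule.zero_mem _
      | succ m =>
        rw [schwartzAnn_hermiteFun_succ]
        exact Submodule.smul_mem _ _ (Submodule.subset_span ⟨_, rfl⟩)
    exact hle ih

theorem schwartzX_pow_gaussian_apply (n : ℕ) (x : ℝ) :
    (schwartzX ^ n) gaussian x = (x : ℂ) ^ n * gaussian x := by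
  induction n with
  | zero => simp
  | succ n ih =>
    rw [pow_succ', mul_apply_eq_comp, schwartzX_apply, ih]
    ring

/-- A locally integrable function whose integral against every Schwartz function vanishes is zero. -/
theorem ae_eq_zero_of_integral_schwartz {F : ℝ → ℂ} (hF : LocallyIntegrable F)
    (h : ∀ ψ : 𝓢(ℝ, ℂ), ∫ x, F x * ψ x = 0) : F =ᵐ[volume] 0 := by
  refine ae_eq_zero_of_integral_contDiff_smul_eq_zero hF fun g hg hc => ?_
  have h1 : HasCompactSupport fun x => (g x : ℂ) := hc.comp_left Complex.ofReal_zero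
  have h2 := h (h1.toSchwartzMap (Complex.ofRealCLM.contDiff.comp hg))
  rw [← h2]
  refine integral_congr_ae (Filter.Eventually.of_forall fun x => ?_)
  exact (Complex.real_smul).trans (mul_comm _ _)

/-- Injectivity of the Fourier transform on `L¹`: a Schwartz `ψ` is the transform of its inverse
transform, and moving the transform onto `F` makes `∫ F ψ` vanish. -/
theorem ae_eq_zero_of_fourier_eq_zero {F : ℝ → ℂ} (hF : Integrable F)
    (h : ∀ t : ℝ, ∫ x : ℝ, Complex.exp (t * x * Complex.I) * F x = 0) : F =ᵐ[volume] 0 := by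
  refine ae_eq_zero_of_integral_schwartz hF.locallyIntegrable fun ψ => ?_
  have hz : ∀ ξ, FourierTransform.fourier F ξ = 0 := fun ξ => by
    rw [Real.fourier_real_eq_integral_exp_smul, ← h (-2 * Real.pi * ξ)]
    congr 1
    funext x
    rw [smul_eq_mul]
    congr 2
    push_cast
    ring
  have h1 := VectorFourier.integral_fourierIntegral_smul_eq_flip (μ := volume) (ν := volume)
    (L := innerₗ ℝ) Real.continuous_fourierChar continuous_inner hF
    (FourierTransformInv.fourierInv ψ).integrable
  have h2 : ∀ x, FourierTransform.fourier (FourierTransformInv.fourierInv ψ : ℝ → ℂ) x = ψ x := by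
    intro x
    rw [← SchwartzMap.fourier_coe, FourierTransform.fourier_fourierInv_eq]
  have h3 : ∀ x, VectorFourier.fourierIntegral Real.fourierChar volume (innerₗ ℝ).flip
      (FourierTransformInv.fourierInv ψ : ℝ → ℂ) x = ψ x := by
    intro x
    rw [flip_innerₗ]
    exact h2 x
  simp only [h3, smul_eq_mul] at h1
  rw [← h1]
  have h4 : ∀ ξ, VectorFourier.fourierIntegral Real.fourierChar volume (innerₗ ℝ) F ξ = 0 := hz
  simp [h4]

theorem memLp_exp_mul_gaussian (t : ℝ) :
    MemLp (fun x : ℝ => Real.exp (|t * x|) * Real.exp (-(x ^ 2 / 2))) 2 volume := by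
  have hm : AEStronglyMeasurable (fun x : ℝ => Real.exp (|t * x|) * Real.exp (-(x ^ 2 / 2)))
      volume := (by fun_prop : Continuous _).aestronglyMeasurable
  rw [memLp_two_iff_integrable_sq hm]
  have hg : Integrable fun x : ℝ => Real.exp (2 * t ^ 2) * Real.exp (-(1 / 2) * x ^ 2) :=
    (integrable_exp_neg_mul_sq (by norm_num)).const_mul _
  refine hg.mono' (hm.pow 2) (Filter.Eventually.of_forall fun x => ?_)
  rw [Real.norm_eq_abs, abs_of_nonneg (by positivity), ← Real.exp_add, ← Real.exp_add,
    ← Real.exp_nat_mul, Real.exp_le_exp]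
  -- This gives `2|tx| ≤ 2t² + x²/2`, whence the majorant `e^{2t²} e^{-x²/2}` of the square.
  have := sq_nonneg (|t| - |x| / 2)
  rw [abs_mul]
  push_cast
  nlinarith [sq_abs t, sq_abs x]

/-- All moments of `e^{-x²/2} f` vanish. Expanding `e^{itx}` in powers, with `e^{|tx|} e^{-x²/2}
|f|` as integrable majorant, shows that its Fourier transform vanishes, and the Gaussian has no
zeros. -/
theorem eq_zero_of_inner_hermiteFun {f : L2}
    (h : ∀ n, inner ℂ (toL2 (hermiteFun n)) f = 0) : f = 0 := by
  have hspan : ∀ φ ∈ Submodule.span ℂ (Set.range hermiteFun), inner ℂ (toL2 φ) f = 0 := by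
    intro φ hφ
    induction hφ using Submodule.span_induction with
    | mem φ hφ => obtain ⟨n, rfl⟩ := hφ; exact h n
    | zero => simp
    | add φ ψ _ _ h1 h2 => rw [map_add, inner_add_left, h1, h2, add_zero]
    | smul c φ _ h1 => rw [map_smul, inner_smul_left, h1, mul_zero]
  have hmom : ∀ n : ℕ, ∫ x : ℝ, (x : ℂ) ^ n * ((Real.exp (-(x ^ 2 / 2)) : ℝ) * f x) = 0 := by
    intro n
    rw [← hspan _ (schwartzX_pow_gaussian_mem_span n), L2.inner_def]
    refine integral_congr_ae ?_
    filter_upwards [((schwartzX ^ n) gaussian).coeFn_toLp 2 volume] with x hx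
    rw [toL2_apply, hx, schwartzX_pow_gaussian_apply, gaussian_apply, RCLike.inner_apply]
    simp only [map_mul, map_pow, Complex.conj_ofReal]
    ring
  have hint : ∀ t : ℝ, Integrable fun x : ℝ =>
      Real.exp (|t * x|) * Real.exp (-(x ^ 2 / 2)) * ‖f x‖ := fun t =>
    (memLp_exp_mul_gaussian t).integrable_mul (Lp.memLp f).norm
  have hmeas : AEStronglyMeasurable (fun x : ℝ => ((Real.exp (-(x ^ 2 / 2)) : ℝ) : ℂ) * f x)
      volume := (by fun_prop : Continuous fun x : ℝ =>
        ((Real.exp (-(x ^ 2 / 2)) : ℝ) : ℂ)).aestronglyMeasurable.mul (Lp.aestronglyMeasurable f)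
  have hF : Integrable fun x : ℝ => ((Real.exp (-(x ^ 2 / 2)) : ℝ) : ℂ) * f x := by
    refine (hint 0).mono' hmeas (Filter.Eventually.of_forall fun x => ?_)
    simp [-Complex.ofReal_exp]
  have hzero := ae_eq_zero_of_fourier_eq_zero hF fun t => by
    have hs := hasSum_integral_of_dominated_convergence (μ := volume)
      (F := fun (n : ℕ) (x : ℝ) => (t * x * Complex.I) ^ n / (n.factorial : ℂ) *
        (((Real.exp (-(x ^ 2 / 2)) : ℝ) : ℂ) * f x))
      (f := fun x : ℝ => Complex.exp (t * x * Complex.I) *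
        (((Real.exp (-(x ^ 2 / 2)) : ℝ) : ℂ) * f x))
      (fun n x => |t * x| ^ n / n.factorial * (Real.exp (-(x ^ 2 / 2)) * ‖f x‖))
      (fun n => (by fun_prop : Continuous fun x : ℝ =>
        (t * x * Complex.I) ^ n / (n.factorial : ℂ)).aestronglyMeasurable.mul hmeas)
      (fun n => Filter.Eventually.of_forall fun x => by
        simp [-Complex.ofReal_exp, abs_mul])
      (Filter.Eventually.of_forall fun x =>
        (Real.summable_pow_div_factorial _).mul_right _)
      (by
        refine (hint t).congr (Filter.Eventually.of_forall fun x => ?_)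
        have : HasSum (fun n : ℕ => |t * x| ^ n / n.factorial) (Real.exp |t * x|) := by
          rw [Real.exp_eq_exp_ℝ]
          exact NormedSpace.expSeries_div_hasSum_exp _
        change _ = ∑' n : ℕ, _
        rw [tsum_mul_right, this.tsum_eq]
        exact mul_assoc _ _ _)
      (Filter.Eventually.of_forall fun x => by
        refine HasSum.mul_right _ ?_
        rw [Complex.exp_eq_exp_ℂ]
        exact NormedSpace.expSeries_div_hasSum_exp _)
    refine hs.unique ?_
    convert hasSum_zero using 1
    funext n
    have : ∀ x : ℝ, (t * x * Complex.I) ^ n / (n.factorial : ℂ) *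
        (((Real.exp (-(x ^ 2 / 2)) : ℝ) : ℂ) * f x) = ((t * Complex.I) ^ n / n.factorial) *
          ((x : ℂ) ^ n * ((Real.exp (-(x ^ 2 / 2)) : ℝ) * f x)) := fun x => by ring
    simp only [this]
    rw [integral_const_mul, hmom, mul_zero]
  rw [Lp.eq_zero_iff_ae_eq_zero]
  filter_upwards [hzero] with x hx
  have h0 : ((Real.exp (-(x ^ 2 / 2)) : ℝ) : ℂ) ≠ 0 := by
    exact_mod_cast (Real.exp_pos _).ne'
  exact (mul_eq_zero.1 hx).resolve_left h0

/-- The Hermite basis of `L²(ℝ)`. -/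
def hermiteBasis : HilbertBasis ℕ ℂ L2 :=
  HilbertBasis.mkOfOrthogonalEqBot orthonormal_hermiteFun (by
    rw [eq_bot_iff]
    intro f hf
    refine eq_zero_of_inner_hermiteFun fun n => ?_
    exact (Submodule.mem_orthogonal _ _).1 hf _ (Submodule.subset_span ⟨n, rfl⟩))

theorem hermiteBasis_apply (n : ℕ) : hermiteBasis n = toL2 (hermiteFun n) := by
  rw [hermiteBasis, HilbertBasis.coe_mkOfOrthogonalEqBot]

end Hermite

/-! ### Expansions in a Hilbert basis -/

section HilbertBasis

variable {ι E : Type*} [NormedAddCommGroup E] [InnerProductSpace ℂ E] (b : HilbertBasis ι ℂ E)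

theorem hasSum_norm_sq_inner (f : E) : HasSum (fun i => ‖inner ℂ (b i) f‖ ^ 2) (‖f‖ ^ 2) := by
  have h := b.hasSum_inner_mul_inner f f
  rw [inner_self_eq_norm_sq_to_K] at h
  rw [← Complex.hasSum_ofReal]
  have e : ∀ i, inner ℂ f (b i) * inner ℂ (b i) f =
      ((‖inner ℂ (b i) f‖ ^ 2 : ℝ) : ℂ) := fun i => by
    rw [← inner_conj_symm, Complex.conj_mul']
    push_cast; rfl
  simp only [e] at h
  rw [Complex.ofReal_pow]
  exact h

/-- Riesz–Fischer; it produces the candidates for `a f` and `a* f` from their coefficients. -/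
theorem exists_inner_eq {c : ι → ℂ} (hc : Summable fun i => ‖c i‖ ^ 2) :
    ∃ g : E, ∀ i, inner ℂ (b i) g = c i := by
  have hm : Memℓp c 2 := by
    rw [memℓp_gen_iff (by norm_num)]
    simpa using hc
  refine ⟨b.repr.symm ⟨c, hm⟩, fun i => ?_⟩
  rw [← b.repr_apply_apply, LinearIsometryEquiv.apply_symm_apply]

theorem ext_inner_basis {f g : E} (h : ∀ i, inner ℂ (b i) f = inner ℂ (b i) g) : f = g := by
  apply b.repr.injective
  ext i
  rw [b.repr_apply_apply, b.repr_apply_apply, h]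

end HilbertBasis

/-! ### The annihilation and creation operators in the Hermite basis -/

section Ladder

/-- `toLinearPMap` has the intended values only for a single-valued graph, which is the assumption
`hG`. -/
theorem exists_apply_eq {E F : Type*} [AddCommGroup E] [Module ℂ E] [AddCommGroup F] [Module ℂ F]
    {G : Submodule ℂ (E × F)}
    (hG : ∀ x : E × F, x ∈ G → x.1 = 0 → x.2 = 0) {f : E} {g : F} (h : (f, g) ∈ G) :
    ∃ hf : f ∈ G.toLinearPMap.domain, G.toLinearPMap ⟨f, hf⟩ = g := by
  have hf : f ∈ G.toLinearPMap.domain := ⟨(f, g), h, rfl⟩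
  refine ⟨hf, ?_⟩
  have h1 := G.mem_graph_toLinearPMap hG ⟨f, hf⟩
  have h2 := hG _ (G.sub_mem h1 h) (by simp)
  exact sub_eq_zero.1 h2

theorem eq_zero_of_mem_derivGraph (p : L2 × L2) (hp : p ∈ derivGraph) (h0 : p.1 = 0) :
    p.2 = 0 := by
  refine ext_inner_basis hermiteBasis fun n => ?_
  have := hp (hermiteFun n)
  rw [h0, inner_zero_right, eq_comm, neg_eq_zero] at this
  rw [hermiteBasis_apply, inner_zero_right]
  exact this

theorem eq_zero_of_mem_mulGraph (p : L2 × L2) (hp : p ∈ mulGraph) (h0 : p.1 = 0) :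
    p.2 = 0 := by
  have h : p.2 =ᵐ[volume] fun x : ℝ => (x : ℂ) * p.1 x := hp
  rw [Lp.eq_zero_iff_ae_eq_zero]
  rw [h0] at h
  filter_upwards [h, Lp.coeFn_zero ℂ 2 (volume : Measure ℝ)] with x hx h1
  rw [hx, h1]
  simp

theorem inner_ddx (φ : 𝓢(ℝ, ℂ)) (f : ddx.domain) :
    inner ℂ (toL2 φ) (ddx f) = -inner ℂ (toL2 (SchwartzMap.derivCLM ℂ ℂ φ)) (f : L2) := by
  have : (((f : L2), ddx f) : L2 × L2) ∈ derivGraph :=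
    derivGraph.mem_graph_toLinearPMap eq_zero_of_mem_derivGraph f
  have h : inner ℂ (toL2 (SchwartzMap.derivCLM ℂ ℂ φ)) (f : L2) = -inner ℂ (toL2 φ) (ddx f) :=
    this φ
  rw [h, neg_neg]

theorem inner_schwartzX_eq (φ : 𝓢(ℝ, ℂ)) (f : L2) :
    inner ℂ (toL2 (schwartzX φ)) f = ∫ x : ℝ, (x : ℂ) * f x * starRingEnd ℂ (φ x) := by
  rw [L2.inner_def]
  refine integral_congr_ae ?_
  filter_upwards [(schwartzX φ).coeFn_toLp 2 volume] with x hx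
  rw [toL2_apply, hx, RCLike.inner_apply, schwartzX_apply, map_mul, Complex.conj_ofReal]
  ring

theorem inner_mulX (φ : 𝓢(ℝ, ℂ)) (f : mulX.domain) :
    inner ℂ (toL2 φ) (mulX f) = inner ℂ (toL2 (schwartzX φ)) (f : L2) := by
  have h : mulX f =ᵐ[volume] fun x : ℝ => (x : ℂ) * (f : L2) x :=
    mulGraph.mem_graph_toLinearPMap eq_zero_of_mem_mulGraph f
  rw [inner_schwartzX_eq, L2.inner_def]
  refine integral_congr_ae ?_
  filter_upwards [h, φ.coeFn_toLp 2 volume] with x hx hφ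
  rw [toL2_apply, hφ, hx, RCLike.inner_apply]

/-- The fundamental lemma of the calculus of variations applied to `x f - g`. The conjugates appear
because the inner product is antilinear in the test function, while the vanishing criterion is
bilinear. -/
theorem mem_mulGraph_of_inner {f g : L2}
    (h : ∀ φ : 𝓢(ℝ, ℂ), inner ℂ (toL2 (schwartzX φ)) f = inner ℂ (toL2 φ) g) :
    (f, g) ∈ mulGraph := by
  have hloc : LocallyIntegrable fun x : ℝ => starRingEnd ℂ ((x : ℂ) * f x - g x) := by
    have hf : LocallyIntegrable f := (Lp.memLp f).locallyIntegrable (by norm_num)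
    have hg : LocallyIntegrable g := (Lp.memLp g).locallyIntegrable (by norm_num)
    have hxf : LocallyIntegrable fun x : ℝ => (x : ℂ) * f x := by
      have := hf.locallyIntegrableOn Set.univ
      rw [← locallyIntegrableOn_univ]
      exact this.continuousOn_mul Complex.continuous_ofReal.continuousOn isOpen_univ.isLocallyClosed
    have hd := hxf.sub hg
    exact hd.mono (Complex.continuous_conj.comp_aestronglyMeasurable hd.aestronglyMeasurable)
      (Filter.Eventually.of_forall fun x => (RCLike.norm_conj _).le)
  have hz := ae_eq_zero_of_integral_schwartz hloc fun ψ => by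
    have h1 : Integrable fun x : ℝ => (x : ℂ) * f x * starRingEnd ℂ (ψ x) := by
      refine (L2.integrable_inner (𝕜 := ℂ) (toL2 (schwartzX ψ)) f).congr ?_
      filter_upwards [(schwartzX ψ).coeFn_toLp 2 volume] with x hx
      rw [toL2_apply, hx, RCLike.inner_apply, schwartzX_apply, map_mul, Complex.conj_ofReal]
      ring
    have h2 : Integrable fun x : ℝ => g x * starRingEnd ℂ (ψ x) := by
      refine (L2.integrable_inner (𝕜 := ℂ) (toL2 ψ) g).congr ?_
      filter_upwards [ψ.coeFn_toLp 2 volume] with x hx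
      rw [toL2_apply, hx, RCLike.inner_apply]
    have h3 : inner ℂ (toL2 ψ) g = ∫ x : ℝ, g x * starRingEnd ℂ (ψ x) := by
      rw [L2.inner_def]
      refine integral_congr_ae ?_
      filter_upwards [ψ.coeFn_toLp 2 volume] with x hx
      rw [toL2_apply, hx, RCLike.inner_apply]
    have h4 : ∫ x : ℝ, ((x : ℂ) * f x * starRingEnd ℂ (ψ x) - g x * starRingEnd ℂ (ψ x)) = 0 := by
      rw [integral_sub h1 h2, ← inner_schwartzX_eq, ← h3, h, sub_self]
    have h5 := congrArg (starRingEnd ℂ) h4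
    rw [← integral_conj, map_zero] at h5
    rw [← h5]
    congr 1
    funext x
    simp only [map_sub, map_mul, Complex.conj_conj]
    ring
  change g =ᵐ[volume] fun x : ℝ => (x : ℂ) * f x
  filter_upwards [hz] with x hx
  have hx' : starRingEnd ℂ ((x : ℂ) * f x - g x) = 0 := hx
  rw [map_eq_zero, sub_eq_zero] at hx'
  exact hx'.symm

theorem domain_cre : cre.domain = ann.domain := rfl

theorem inner_ann (φ : 𝓢(ℝ, ℂ)) (f : ann.domain) :
    inner ℂ (toL2 φ) (ann f) = inner ℂ (toL2 (schwartzCre φ)) (f : L2) := by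
  have h : ann f = (1 / (√2 : ℝ) : ℂ) • (ddx ⟨f, f.2.1⟩ + mulX ⟨f, f.2.2⟩) := rfl
  rw [h, inner_smul_right, inner_add_right, inner_ddx, inner_mulX, schwartzCre]
  simp only [smul_apply, add_apply, neg_apply, map_smul, map_add, map_neg, inner_smul_left,
    inner_add_left, inner_neg_left]
  simp

theorem inner_cre (φ : 𝓢(ℝ, ℂ)) (f : cre.domain) :
    inner ℂ (toL2 φ) (cre f) = inner ℂ (toL2 (schwartzAnn φ)) (f : L2) := by
  have h : cre f = (1 / (√2 : ℝ) : ℂ) • (-ddx ⟨f, f.2.1⟩ + mulX ⟨f, f.2.2⟩) := rfl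
  rw [h, inner_smul_right, inner_add_right, inner_neg_right, inner_ddx, inner_mulX, schwartzAnn]
  simp only [smul_apply, add_apply, map_smul, map_add, inner_smul_left,
    inner_add_left]
  simp

/-- The coefficients of `f` in the Hermite basis. -/
def coeff (n : ℕ) (f : L2) : ℂ := inner ℂ (hermiteBasis n) f

theorem coeff_add (n : ℕ) (f g : L2) : coeff n (f + g) = coeff n f + coeff n g :=
  inner_add_right _ _ _

theorem coeff_sub (n : ℕ) (f g : L2) : coeff n (f - g) = coeff n f - coeff n g :=
  inner_sub_right _ _ _

theorem coeff_smul (n : ℕ) (c : ℂ) (f : L2) : coeff n (c • f) = c * coeff n f :=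
  inner_smul_right _ _ _

theorem coeff_ext {f g : L2} (h : ∀ n, coeff n f = coeff n g) : f = g :=
  ext_inner_basis hermiteBasis h

theorem coeff_ann (n : ℕ) (f : ann.domain) :
    coeff n (ann f) = (√(n + 1 : ℝ) : ℝ) * coeff (n + 1) f := by
  rw [coeff, coeff, hermiteBasis_apply, inner_ann, schwartzCre_hermiteFun, map_smul,
    inner_smul_left, Complex.conj_ofReal, hermiteBasis_apply]

theorem coeff_cre_zero (f : cre.domain) : coeff 0 (cre f) = 0 := by
  rw [coeff, hermiteBasis_apply, inner_cre, schwartzAnn_hermiteFun_zero]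
  simp

theorem coeff_cre_succ (n : ℕ) (f : cre.domain) :
    coeff (n + 1) (cre f) = (√(n + 1 : ℝ) : ℝ) * coeff n f := by
  rw [coeff, coeff, hermiteBasis_apply, inner_cre, schwartzAnn_hermiteFun_succ, map_smul,
    inner_smul_left, Complex.conj_ofReal, hermiteBasis_apply]

theorem hasSum_coeff (f g : L2) :
    HasSum (fun n => starRingEnd ℂ (coeff n f) * coeff n g) (inner ℂ f g) := by
  refine (hermiteBasis.hasSum_inner_mul_inner f g).congr_fun fun n => ?_
  change _ = inner ℂ f (hermiteBasis n) * inner ℂ (hermiteBasis n) g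
  rw [← inner_conj_symm f]
  rfl

/-- If the coefficients of `u'`, `v'` are those of `a u`, `a* v` then `(u', v) = (u, v')`. -/
theorem inner_eq_of_coeff {u u' v v' : L2}
    (hu : ∀ n : ℕ, coeff n u' = (√(n + 1 : ℝ) : ℝ) * coeff (n + 1) u)
    (hv0 : coeff 0 v' = 0)
    (hv : ∀ n : ℕ, coeff (n + 1) v' = (√(n + 1 : ℝ) : ℝ) * coeff n v) :
    inner ℂ u' v = inner ℂ u v' := by
  rw [← (hasSum_coeff u' v).tsum_eq, ← (hasSum_coeff u v').tsum_eq,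
    (hasSum_coeff u v').summable.tsum_eq_zero_add, hv0, mul_zero, zero_add]
  refine tsum_congr fun n => ?_
  rw [hu, hv, map_mul, Complex.conj_ofReal]
  ring

theorem inner_ann_left (f : ann.domain) (g : cre.domain) :
    inner ℂ (ann f) (g : L2) = inner ℂ (f : L2) (cre g) :=
  inner_eq_of_coeff (fun n => coeff_ann n f) (coeff_cre_zero g) fun n => coeff_cre_succ n g

theorem inner_cre_left (f : cre.domain) (g : ann.domain) :
    inner ℂ (cre f) (g : L2) = inner ℂ (f : L2) (ann g) := by
  rw [← inner_conj_symm, ← inner_ann_left, inner_conj_symm]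

theorem coeff_schwartzAnn (n : ℕ) (φ : 𝓢(ℝ, ℂ)) :
    coeff n (toL2 (schwartzAnn φ)) = (√(n + 1 : ℝ) : ℝ) * coeff (n + 1) (toL2 φ) := by
  rw [coeff, coeff, hermiteBasis_apply, ← inner_schwartzCre_left, schwartzCre_hermiteFun, map_smul,
    inner_smul_left, Complex.conj_ofReal, hermiteBasis_apply]

theorem coeff_schwartzCre_zero (φ : 𝓢(ℝ, ℂ)) : coeff 0 (toL2 (schwartzCre φ)) = 0 := by
  rw [coeff, hermiteBasis_apply, ← inner_schwartzAnn_left, schwartzAnn_hermiteFun_zero]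
  simp

theorem coeff_schwartzCre_succ (n : ℕ) (φ : 𝓢(ℝ, ℂ)) :
    coeff (n + 1) (toL2 (schwartzCre φ)) = (√(n + 1 : ℝ) : ℝ) * coeff n (toL2 φ) := by
  rw [coeff, coeff, hermiteBasis_apply, ← inner_schwartzAnn_left, schwartzAnn_hermiteFun_succ,
    map_smul, inner_smul_left, Complex.conj_ofReal, hermiteBasis_apply]

theorem derivCLM_eq (φ : 𝓢(ℝ, ℂ)) : SchwartzMap.derivCLM ℂ ℂ φ =
    (1 / (√2 : ℝ) : ℂ) • (schwartzAnn φ - schwartzCre φ) := by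
  simp only [schwartzAnn, schwartzCre, smul_apply, add_apply, neg_apply, smul_add, smul_sub,
    smul_smul, inv_sqrt_two_mul_self, smul_neg]
  module

/-- Both candidates are needed: with `u` for `a f` and `v` for `a* f`, the function `(u - v)/√2` is
the weak derivative and `(u + v)/√2` is `x f`. -/
theorem mem_domain_ann_of_coeff {f u v : L2}
    (hu : ∀ n : ℕ, coeff n u = (√(n + 1 : ℝ) : ℝ) * coeff (n + 1) f)
    (hv0 : coeff 0 v = 0)
    (hv : ∀ n : ℕ, coeff (n + 1) v = (√(n + 1 : ℝ) : ℝ) * coeff n f) : f ∈ ann.domain := by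
  have h1 : ∀ φ : 𝓢(ℝ, ℂ), inner ℂ (toL2 (schwartzAnn φ)) f = inner ℂ (toL2 φ) v := fun φ =>
    inner_eq_of_coeff (fun n => coeff_schwartzAnn n φ) hv0 hv
  have h2 : ∀ φ : 𝓢(ℝ, ℂ), inner ℂ (toL2 (schwartzCre φ)) f = inner ℂ (toL2 φ) u := fun φ => by
    rw [← inner_conj_symm, ← inner_eq_of_coeff hu (coeff_schwartzCre_zero φ)
      (fun n => coeff_schwartzCre_succ n φ), inner_conj_symm]
  have h3 : (f, (1 / (√2 : ℝ) : ℂ) • (u - v)) ∈ derivGraph := fun φ => by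
    change inner ℂ (toL2 (SchwartzMap.derivCLM ℂ ℂ φ)) f =
      -inner ℂ (toL2 φ) ((1 / (√2 : ℝ) : ℂ) • (u - v))
    rw [derivCLM_eq, map_smul, map_sub, inner_smul_left, inner_sub_left, h1, h2, inner_smul_right,
      inner_sub_right]
    simp
    ring
  have h4 : (f, (1 / (√2 : ℝ) : ℂ) • (u + v)) ∈ mulGraph := mem_mulGraph_of_inner fun φ => by
    rw [schwartzX_eq, map_smul, map_add, inner_smul_left, inner_add_left, h1, h2, inner_smul_right,
      inner_add_right]
    simp
    ring
  exact ⟨(exists_apply_eq eq_zero_of_mem_derivGraph h3).1,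
    (exists_apply_eq eq_zero_of_mem_mulGraph h4).1⟩

theorem norm_sqrt_mul_sq (n : ℕ) (z : ℂ) :
    ‖((√(n + 1 : ℝ) : ℝ) : ℂ) * z‖ ^ 2 = (n + 1) * ‖z‖ ^ 2 := by
  rw [norm_mul, mul_pow, Complex.norm_real, Real.norm_eq_abs, sq_abs,
    Real.sq_sqrt (by positivity)]

theorem mem_domain_ann_iff {f : L2} :
    f ∈ ann.domain ↔ Summable fun n : ℕ => (n : ℝ) * ‖coeff n f‖ ^ 2 := by
  constructor
  · intro hf
    rw [← summable_nat_add_iff 1]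
    refine (hasSum_norm_sq_inner hermiteBasis (ann ⟨f, hf⟩)).summable.congr fun n => ?_
    change ‖coeff n (ann ⟨f, hf⟩)‖ ^ 2 = _
    rw [coeff_ann, norm_sqrt_mul_sq]
    push_cast; rfl
  · intro hf
    have h0 : Summable fun n => ‖coeff n f‖ ^ 2 := (hasSum_norm_sq_inner hermiteBasis f).summable
    obtain ⟨u, hu⟩ := exists_inner_eq hermiteBasis
      (c := fun n => ((√(n + 1 : ℝ) : ℝ) : ℂ) * coeff (n + 1) f) (by
        refine ((summable_nat_add_iff 1).2 hf).congr fun n => ?_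
        rw [norm_sqrt_mul_sq]
        push_cast; rfl)
    obtain ⟨v, hv⟩ := exists_inner_eq hermiteBasis
      (c := fun n => Nat.casesOn n 0 fun m => ((√(m + 1 : ℝ) : ℝ) : ℂ) * coeff m f) (by
        rw [← summable_nat_add_iff 1]
        refine (hf.add h0).congr fun n => ?_
        rw [norm_sqrt_mul_sq]
        ring)
    exact mem_domain_ann_of_coeff hu (hv 0) fun n => hv (n + 1)

theorem domain_num_le : num.domain ≤ ann.domain := fun _ hf => hf.1

theorem num_apply (f : num.domain) : num f = cre ⟨ann ⟨f, f.2.1⟩, f.2.2⟩ := rfl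

theorem coeff_num (n : ℕ) (f : num.domain) : coeff n (num f) = n * coeff n f := by
  rw [num_apply]
  cases n with
  | zero => rw [coeff_cre_zero]; simp
  | succ n =>
    rw [coeff_cre_succ]
    change _ * coeff n (ann ⟨f, f.2.1⟩) = _
    rw [coeff_ann, ← mul_assoc, sqrt_mul_self_cast]
    push_cast; rfl

/-- For the converse, `n ≤ n²` puts `f` in the domain of `a`, and `a f` has coefficients `√(n+1)
c_{n+1}`, so that `a f` lies in the domain of `a*` because `n(n+1) ≤ (n+1)²`. -/
theorem mem_domain_num_iff {f : L2} :
    f ∈ num.domain ↔ Summable fun n : ℕ => (n : ℝ) ^ 2 * ‖coeff n f‖ ^ 2 := by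
  constructor
  · intro hf
    refine (hasSum_norm_sq_inner hermiteBasis (num ⟨f, hf⟩)).summable.congr fun n => ?_
    change ‖coeff n (num ⟨f, hf⟩)‖ ^ 2 = _
    rw [coeff_num, norm_mul, mul_pow]
    simp
  · intro hf
    have h1 : f ∈ ann.domain := by
      rw [mem_domain_ann_iff]
      refine hf.of_nonneg_of_le (fun n => by positivity) fun n => ?_
      gcongr
      exact_mod_cast Nat.le_self_pow (by norm_num) n
    refine ⟨h1, ?_⟩
    rw [domain_cre, mem_domain_ann_iff]
    refine ((summable_nat_add_iff 1).2 hf).of_nonneg_of_le (fun n => by positivity) fun n => ?_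
    rw [coeff_ann, norm_sqrt_mul_sq, ← mul_assoc]
    gcongr
    push_cast
    nlinarith

theorem inner_num_left (f g : num.domain) :
    inner ℂ (num f) (g : L2) = inner ℂ (f : L2) (num g) := by
  rw [num_apply, num_apply]
  rw [inner_cre_left ⟨ann ⟨f, f.2.1⟩, f.2.2⟩ ⟨g, g.2.1⟩,
    ← inner_ann_left ⟨f, f.2.1⟩ ⟨ann ⟨g, g.2.1⟩, g.2.2⟩]

end Ladder

/-! ### Diagonal operators -/

section Diagonal

open Filter Topology

variable {E : Type*} [NormedAddCommGroup E] [InnerProductSpace ℂ E]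

theorem norm_le_of_inner_basis_le {ι : Type*} (b : HilbertBasis ι ℂ E) {u f : E} {C : ℝ}
    (hC : 0 ≤ C) (h : ∀ i, ‖inner ℂ (b i) u‖ ≤ C * ‖inner ℂ (b i) f‖) : ‖u‖ ≤ C * ‖f‖ := by
  refine (sq_le_sq₀ (norm_nonneg _) (by positivity)).1 ?_
  rw [mul_pow]
  refine hasSum_le (fun i => ?_) (hasSum_norm_sq_inner b u)
    ((hasSum_norm_sq_inner b f).mul_left (C ^ 2))
  rw [← mul_pow]
  exact pow_le_pow_left₀ (norm_nonneg _) (h i) 2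

theorem exists_diagonal (b : HilbertBasis ℕ ℂ E) {d : ℕ → ℝ} {C : ℝ} (hC : 0 ≤ C)
    (hd : ∀ n, |d n| ≤ C) :
    ∃ D : E →L[ℂ] E, ∀ n f, inner ℂ (b n) (D f) = d n * inner ℂ (b n) f := by
  have hle : ∀ n (z : ℂ), ‖(d n : ℂ) * z‖ ≤ C * ‖z‖ := fun n z => by
    rw [norm_mul, Complex.norm_real, Real.norm_eq_abs]
    exact mul_le_mul_of_nonneg_right (hd n) (norm_nonneg _)
  have hex : ∀ f : E, ∃ g : E, ∀ n, inner ℂ (b n) g = d n * inner ℂ (b n) f := fun f => by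
    refine exists_inner_eq b (((hasSum_norm_sq_inner b f).summable.mul_left (C ^ 2)).of_nonneg_of_le
      (fun n => by positivity) fun n => ?_)
    rw [← mul_pow]
    exact pow_le_pow_left₀ (norm_nonneg _) (hle n _) 2
  choose D hD using hex
  let L : E →ₗ[ℂ] E :=
    { toFun := D
      map_add' := fun f g => ext_inner_basis b fun n => by
        rw [hD, inner_add_right, inner_add_right, hD, hD, mul_add]
      map_smul' := fun c f => ext_inner_basis b fun n => by
        rw [hD, inner_smul_right, RingHom.id_apply, inner_smul_right, hD, mul_left_comm] }
  refine ⟨L.mkContinuous C fun f => norm_le_of_inner_basis_le b hC fun n => ?_, fun n f => hD f n⟩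
  change ‖inner ℂ (b n) (D f)‖ ≤ _
  rw [hD]
  exact hle n _

/-- The operator is the norm limit of its finite-rank truncations. -/
theorem isCompactOperator_of_diagonal [CompleteSpace E] (b : HilbertBasis ℕ ℂ E) {d : ℕ → ℝ}
    (hd : Tendsto d atTop (𝓝 0)) {D : E →L[ℂ] E}
    (hD : ∀ n f, inner ℂ (b n) (D f) = d n * inner ℂ (b n) f) : IsCompactOperator D := by
  let F : ℕ → E →L[ℂ] E := fun N =>
    ∑ n ∈ Finset.range N, (d n : ℂ) • (innerSL ℂ (b n)).smulRight (b n)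
  have hF : ∀ N, IsCompactOperator (F N) := fun N => by
    have : F N ∈ compactOperator (RingHom.id ℂ) E E := by
      refine Submodule.sum_mem _ fun n _ => Submodule.smul_mem _ _ ?_
      have h1 : IsCompactOperator (innerSL ℂ (b n)) :=
        isCompactOperator_of_locallyCompactSpace_dom _
      exact h1.clm_comp (ContinuousLinearMap.toSpanSingleton ℂ (b n))
    exact this
  have hFc : ∀ N n f, inner ℂ (b n) (F N f) =
      if n < N then (d n : ℂ) * inner ℂ (b n) f else 0 := fun N n f => by
    simp only [F, sum_apply, smul_apply, ContinuousLinearMap.smulRight_apply,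
      innerSL_apply_apply, inner_sum, inner_smul_right, orthonormal_iff_ite.1 b.orthonormal]
    simp
  refine isCompactOperator_of_tendsto (l := atTop) (F := F) ?_ (Eventually.of_forall hF)
  rw [Metric.tendsto_atTop]
  intro ε hε
  obtain ⟨N, hN⟩ := Metric.tendsto_atTop.1 hd (ε / 2) (by positivity)
  refine ⟨N, fun M hM => ?_⟩
  rw [dist_eq_norm]
  refine lt_of_le_of_lt (ContinuousLinearMap.opNorm_le_bound _ (by positivity : 0 ≤ ε / 2)
    fun f => norm_le_of_inner_basis_le b (by positivity) fun n => ?_) (half_lt_self hε)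
  rw [sub_apply, inner_sub_right, hFc, hD]
  split_ifs with h
  · rw [sub_self, norm_zero]; positivity
  · rw [zero_sub, norm_neg, norm_mul, Complex.norm_real]
    have := hN n (by omega)
    rw [dist_zero_right] at this
    gcongr

end Diagonal

/-! ### Resolvents -/

section Resolvent

variable {E F : Type*} [NormedAddCommGroup E] [InnerProductSpace ℂ E]
  [NormedAddCommGroup F] [InnerProductSpace ℂ F]

/-- For symmetric `T`, a right inverse of `T + K` suffices: surjectivity and symmetry force
injectivity, hence a two-sided inverse, and `R` inherits the symmetry. -/
theorem HasCompactResolvent.of_symmetric {T : E →ₗ.[ℂ] E} {R : E →L[ℂ] E} {K : ℝ}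
    (hT : ∀ f g : T.domain, inner ℂ (T f) (g : E) = inner ℂ (f : E) (T g))
    (hR : ∀ f : E, ∃ h : R f ∈ T.domain, T ⟨R f, h⟩ + (K : ℂ) • R f = f)
    (hc : IsCompactOperator R) : HasCompactResolvent T R K := by
  have hTK : ∀ f g : T.domain, inner ℂ (T f + (K : ℂ) • (f : E)) (g : E) =
      inner ℂ (f : E) (T g + (K : ℂ) • (g : E)) := fun f g => by
    rw [inner_add_left, inner_add_right, hT, inner_smul_left, inner_smul_right, Complex.conj_ofReal]
  refine ⟨hR, fun f => ?_, hc, fun f g => ?_⟩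
  · obtain ⟨h1, h2⟩ := hR (T f + (K : ℂ) • (f : E))
    refine ext_inner_right ℂ fun u => ?_
    obtain ⟨h3, h4⟩ := hR u
    have h5 := hTK ⟨_, h1⟩ ⟨_, h3⟩
    have h6 := hTK f ⟨_, h3⟩
    rw [h4] at h5 h6
    rw [h2] at h5
    rw [← h5, ← h6]
  · obtain ⟨h1, h2⟩ := hR f
    obtain ⟨h3, h4⟩ := hR g
    have h5 := hTK ⟨_, h1⟩ ⟨_, h3⟩
    rw [h2, h4] at h5
    exact h5.symm

theorem HasCompactResolvent.conj {T : E →ₗ.[ℂ] E} {R : E →L[ℂ] E} {K : ℝ}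
    (h : HasCompactResolvent T R K) (V : E ≃ₗᵢ[ℂ] F) :
    HasCompactResolvent (conj V.toLinearEquiv T)
      ((V.toContinuousLinearEquiv : E →L[ℂ] F) ∘L R ∘L
        (V.symm.toContinuousLinearEquiv : F →L[ℂ] E)) K where
  right_inv f := by
    obtain ⟨h1, h2⟩ := h.right_inv (V.symm f)
    have h3 : V.symm (V (R (V.symm f))) = R (V.symm f) := V.symm_apply_apply _
    have hm : V.symm (V (R (V.symm f))) ∈ T.domain := by rw [h3]; exact h1
    refine ⟨hm, ?_⟩
    change V (T ⟨V.symm (V (R (V.symm f))), hm⟩) + (K : ℂ) • V (R (V.symm f)) = f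
    rw [← map_smul, ← map_add]
    apply V.symm.injective
    rw [V.symm_apply_apply]
    convert h2
  left_inv f := by
    have := h.left_inv ⟨V.symm f, f.2⟩
    change V (R (V.symm (V (T ⟨V.symm f, f.2⟩) + (K : ℂ) • (f : F)))) = f
    rw [map_add, map_smul, V.symm_apply_apply, this]
    exact V.apply_symm_apply _
  compact := (h.compact.comp_clm _).clm_comp _
  symm f g := by
    change inner ℂ (V (R (V.symm f))) g = inner ℂ f (V (R (V.symm g)))
    have h1 := V.inner_map_map (R (V.symm f)) (V.symm g)
    have h2 := V.inner_map_map (V.symm f) (R (V.symm g))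
    rw [V.apply_symm_apply] at h1 h2
    rw [h1, h2, h.symm]

theorem map_mem_eigenspace_conj (V : E ≃ₗ[ℂ] F) {T : E →ₗ.[ℂ] E} {z : ℂ} {f : E} :
    V f ∈ eigenspace (NcHO.conj V T) z ↔ f ∈ eigenspace T z := by
  have hd : ∀ h : V.symm (V f) ∈ T.domain, ∃ hf : f ∈ T.domain, T ⟨_, h⟩ = T ⟨f, hf⟩ := by
    rw [V.symm_apply_apply]
    exact fun h => ⟨h, rfl⟩
  constructor
  · rintro ⟨h1, h2⟩
    obtain ⟨h4, h5⟩ := hd h1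
    refine ⟨h4, V.injective ?_⟩
    rw [← h5, map_smul]
    exact h2
  · rintro ⟨h1, h2⟩
    have h3 : V.symm (V f) ∈ T.domain := by rw [V.symm_apply_apply]; exact h1
    obtain ⟨h4, h5⟩ := hd h3
    refine ⟨h3, ?_⟩
    change V (T ⟨_, h3⟩) = _
    rw [h5, h2, map_smul]

end Resolvent

/-! ### The resolvent of the one-particle non-commutative harmonic oscillator -/

section Oscillator

theorem tensor_apply (M : Matrix (Fin 2) (Fin 2) ℂ) (T : L2 →ₗ.[ℂ] L2) (f : (tensor M T).domain)
    (i : Fin 2) : tensor M T f i = ∑ j, M i j • T ⟨f.1 j, f.2 j⟩ := rfl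

theorem mem_domain_onePNcHO {α β : ℝ} {f : H} :
    f ∈ (onePNcHO α β).domain ↔ ∀ j, f j ∈ num.domain :=
  ⟨fun h j => (h.1 j).1, fun h => ⟨fun j => ⟨h j, trivial⟩,
    fun j => ⟨domain_num_le (h j), domain_num_le (h j)⟩⟩⟩

/-- The operator `a - a*` on `D(a)`. -/
def annSubCre (f : ann.domain) : L2 := ann f - cre f

theorem onePNcHO_apply_zero {α β : ℝ} {f : H} (hf : f ∈ (onePNcHO α β).domain)
    (h : ∀ j, f j ∈ num.domain) :
    onePNcHO α β ⟨f, hf⟩ 0 = (α : ℂ) • (num ⟨f 0, h 0⟩ + (1 / 2 : ℂ) • f 0) -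
      (1 / 2 : ℂ) • annSubCre ⟨f 1, domain_num_le (h 1)⟩ := by
  have e : onePNcHO α β ⟨f, hf⟩ =
      tensor !![(α : ℂ), 0; 0, (β : ℂ)] (num + (1 / 2 : ℂ) • one) ⟨f, hf.1⟩ +
        (1 / 2 : ℂ) • tensor matJ (ann - cre) ⟨f, hf.2⟩ := rfl
  rw [e, PiLp.add_apply, PiLp.smul_apply, tensor_apply, tensor_apply, Fin.sum_univ_two,
    Fin.sum_univ_two]
  simp only [matJ, Matrix.of_apply, Matrix.cons_val', Matrix.cons_val_zero, Matrix.cons_val_one,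
    Matrix.cons_val_fin_one, zero_smul, add_zero, zero_add, neg_smul, one_smul, smul_neg]
  exact (sub_eq_add_neg _ _).symm

theorem onePNcHO_apply_one {α β : ℝ} {f : H} (hf : f ∈ (onePNcHO α β).domain)
    (h : ∀ j, f j ∈ num.domain) :
    onePNcHO α β ⟨f, hf⟩ 1 = (β : ℂ) • (num ⟨f 1, h 1⟩ + (1 / 2 : ℂ) • f 1) +
      (1 / 2 : ℂ) • annSubCre ⟨f 0, domain_num_le (h 0)⟩ := by
  have e : onePNcHO α β ⟨f, hf⟩ =
      tensor !![(α : ℂ), 0; 0, (β : ℂ)] (num + (1 / 2 : ℂ) • one) ⟨f, hf.1⟩ +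
        (1 / 2 : ℂ) • tensor matJ (ann - cre) ⟨f, hf.2⟩ := rfl
  rw [e, PiLp.add_apply, PiLp.smul_apply, tensor_apply, tensor_apply, Fin.sum_univ_two,
    Fin.sum_univ_two]
  simp only [matJ, Matrix.of_apply, Matrix.cons_val', Matrix.cons_val_zero, Matrix.cons_val_one,
    Matrix.cons_val_fin_one, zero_smul, add_zero, zero_add, one_smul]
  rfl

theorem inner_annSubCre_left (f g : ann.domain) :
    inner ℂ (annSubCre f) (g : L2) = -inner ℂ (f : L2) (annSubCre g) := by
  rw [annSubCre, annSubCre, inner_sub_left, inner_sub_right]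
  rw [inner_ann_left f g, inner_cre_left f g, neg_sub]

theorem onePNcHO_symmetric (α β : ℝ) (f g : (onePNcHO α β).domain) :
    inner ℂ (onePNcHO α β f) (g : H) = inner ℂ (f : H) (onePNcHO α β g) := by
  obtain ⟨f, hf⟩ := f
  obtain ⟨g, hg⟩ := g
  have hf' := mem_domain_onePNcHO.1 hf
  have hg' := mem_domain_onePNcHO.1 hg
  rw [PiLp.inner_apply, PiLp.inner_apply, Fin.sum_univ_two, Fin.sum_univ_two,
    onePNcHO_apply_zero hf hf', onePNcHO_apply_one hf hf', onePNcHO_apply_zero hg hg',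
    onePNcHO_apply_one hg hg']
  have h2 : starRingEnd ℂ (1 / 2 : ℂ) = 1 / 2 := by
    simpa using Complex.conj_ofReal (1 / 2)
  simp only [inner_add_left, inner_add_right, inner_sub_left, inner_sub_right, inner_smul_left,
    inner_smul_right, Complex.conj_ofReal, h2]
  rw [inner_num_left ⟨f 0, hf' 0⟩ ⟨g 0, hg' 0⟩, inner_num_left ⟨f 1, hf' 1⟩ ⟨g 1, hg' 1⟩,
    inner_annSubCre_left ⟨f 1, domain_num_le (hf' 1)⟩ ⟨g 0, domain_num_le (hg' 0)⟩,
    inner_annSubCre_left ⟨f 0, domain_num_le (hf' 0)⟩ ⟨g 1, domain_num_le (hg' 1)⟩]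
  ring

theorem hasSum_norm_sq_ann (f : ann.domain) :
    HasSum (fun n : ℕ => (n : ℝ) * ‖coeff n f‖ ^ 2) (‖ann f‖ ^ 2) := by
  rw [← hasSum_nat_add_iff' 1]
  have := hasSum_norm_sq_inner hermiteBasis (ann f)
  simp only [Finset.range_one, Finset.sum_singleton, Nat.cast_zero, zero_mul, sub_zero]
  refine this.congr_fun fun n => ?_
  change _ = ‖coeff n (ann f)‖ ^ 2
  rw [coeff_ann, norm_sqrt_mul_sq]
  push_cast; rfl

theorem hasSum_norm_sq_cre (f : cre.domain) :
    HasSum (fun n : ℕ => (n + 1 : ℝ) * ‖coeff n f‖ ^ 2) (‖cre f‖ ^ 2) := by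
  have h1 : HasSum (fun n => ‖coeff n (cre f)‖ ^ 2) (‖cre f‖ ^ 2) :=
    hasSum_norm_sq_inner hermiteBasis (cre f)
  rw [← hasSum_nat_add_iff' 1] at h1
  simp only [Finset.range_one, Finset.sum_singleton, coeff_cre_zero, norm_zero] at h1
  norm_num at h1
  refine h1.congr_fun fun n => ?_
  rw [coeff_cre_succ, norm_sqrt_mul_sq]

/-- For `αK ≥ 2` the operator `D = (α(a* a + 1/2) + K)⁻¹` is compact and
`‖(a - a*) D‖ ≤ 1`. -/
theorem exists_num_resolvent {α K : ℝ} (hα : 0 < α) (hK : 2 ≤ α * K) :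
    ∃ D W : L2 →L[ℂ] L2, IsCompactOperator D ∧ (∀ f, ‖W f‖ ≤ ‖f‖) ∧
      ∀ f, ∃ h : D f ∈ num.domain,
        (α : ℂ) • (num ⟨D f, h⟩ + (1 / 2 : ℂ) • D f) + (K : ℂ) • D f = f ∧
        annSubCre ⟨D f, domain_num_le h⟩ = W f := by
  have hK0 : 0 < K := by
    by_contra h
    have := mul_nonpos_of_nonneg_of_nonpos hα.le (not_lt.1 h)
    linarith
  set d : ℕ → ℝ := fun n => (α * (n + 1 / 2) + K)⁻¹ with hd_def
  have hpos : ∀ n : ℕ, 0 < α * (n + 1 / 2) + K := fun n => by positivity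
  have hlim : Filter.Tendsto d Filter.atTop (nhds 0) := by
    refine Filter.Tendsto.inv_tendsto_atTop ?_
    refine Filter.tendsto_atTop_add_const_right _ _ (Filter.Tendsto.const_mul_atTop hα ?_)
    exact Filter.tendsto_atTop_add_const_right _ _ tendsto_natCast_atTop_atTop
  have hdK : ∀ n, |d n| ≤ K⁻¹ := fun n => by
    rw [abs_of_pos (inv_pos.2 (hpos n))]
    refine inv_anti₀ hK0 ?_
    have : 0 ≤ α * (n + 1 / 2 : ℝ) := by positivity
    linarith
  -- With `x = n + 1/2`, `(αx + K)² ≥ 4αKx ≥ 8x ≥ 4(n + 1)`. This bounds each of `a D` and `a* D` by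
  -- `1/2`.
  have hd4 : ∀ n : ℕ, (n + 1 : ℝ) * d n ^ 2 ≤ 1 / 4 := fun n => by
    rw [hd_def]
    simp only [inv_pow]
    rw [← div_eq_mul_inv, div_le_div_iff₀ (by have := hpos n; positivity) (by norm_num)]
    have h1 := sq_nonneg (α * (n + 1 / 2 : ℝ) - K)
    have h2 : (2 : ℝ) * (n + 1 / 2) ≤ α * K * (n + 1 / 2) := by gcongr
    have h3 : (0 : ℝ) ≤ n := by positivity
    nlinarith
  -- Follows from `n + 1/2 ≥ (n + 1)/2`; it puts the range of `D` in the domain of the number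
  -- operator.
  have hd1 : ∀ n : ℕ, (n + 1 : ℝ) ^ 2 * d n ^ 2 ≤ (2 / α) ^ 2 := fun n => by
    rw [← mul_pow]
    refine pow_le_pow_left₀ (by have := hpos n; positivity) ?_ 2
    rw [hd_def]
    simp only
    rw [← div_eq_mul_inv, div_le_div_iff₀ (hpos n) hα]
    have h3 : (0 : ℝ) ≤ n := by positivity
    nlinarith
  obtain ⟨D, hD⟩ := exists_diagonal hermiteBasis (inv_pos.2 hK0).le hdK
  have hDc : ∀ n f, coeff n (D f) = d n * coeff n f := hD
  have hDn : ∀ n f, ‖coeff n (D f)‖ ^ 2 = d n ^ 2 * ‖coeff n f‖ ^ 2 := fun n f => by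
    rw [hDc, norm_mul, mul_pow, Complex.norm_real, Real.norm_eq_abs, sq_abs]
  have hsq : ∀ f, HasSum (fun n => ‖coeff n f‖ ^ 2) (‖f‖ ^ 2) := fun f =>
    hasSum_norm_sq_inner hermiteBasis f
  have hdom : ∀ f, D f ∈ num.domain := fun f => by
    rw [mem_domain_num_iff]
    refine ((hsq f).summable.mul_left ((2 / α) ^ 2)).of_nonneg_of_le (fun n => by positivity)
      fun n => ?_
    rw [hDn, ← mul_assoc]
    refine mul_le_mul_of_nonneg_right (le_trans ?_ (hd1 n)) (by positivity)
    gcongr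
    linarith
  have hann : ∀ f, ‖ann ⟨D f, domain_num_le (hdom f)⟩‖ ≤ 1 / 2 * ‖f‖ := fun f => by
    refine (sq_le_sq₀ (norm_nonneg _) (by positivity)).1 ?_
    rw [mul_pow]
    refine hasSum_le (fun n => ?_) (hasSum_norm_sq_ann _) ((hsq f).mul_left _)
    rw [hDn, ← mul_assoc]
    refine mul_le_mul_of_nonneg_right (le_trans ?_ ((hd4 n).trans_eq (by norm_num)))
      (by positivity)
    gcongr
    linarith
  have hcre : ∀ f, ‖cre ⟨D f, domain_num_le (hdom f)⟩‖ ≤ 1 / 2 * ‖f‖ := fun f => by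
    refine (sq_le_sq₀ (norm_nonneg _) (by positivity)).1 ?_
    rw [mul_pow]
    refine hasSum_le (fun n => ?_) (hasSum_norm_sq_cre _) ((hsq f).mul_left _)
    rw [hDn, ← mul_assoc]
    exact mul_le_mul_of_nonneg_right ((hd4 n).trans_eq (by norm_num)) (by positivity)
  let L : L2 →ₗ[ℂ] L2 :=
    { toFun := fun f => (ann - cre) ⟨D f, domain_num_le (hdom f), domain_num_le (hdom f)⟩
      map_add' := fun f g => by
        rw [← (ann - cre).map_add]
        congr 1
        exact Subtype.ext (map_add D f g)
      map_smul' := fun c f => by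
        rw [RingHom.id_apply, ← (ann - cre).map_smul]
        congr 1
        exact Subtype.ext (map_smul D c f) }
  have hL : ∀ f, L f = annSubCre ⟨D f, domain_num_le (hdom f)⟩ := fun f => rfl
  have hLn : ∀ f, ‖L f‖ ≤ 1 * ‖f‖ := fun f => by
    rw [hL, annSubCre]
    exact (norm_sub_le _ _).trans ((add_le_add (hann f) (hcre f)).trans_eq (by ring))
  refine ⟨D, L.mkContinuous 1 hLn, isCompactOperator_of_diagonal hermiteBasis hlim hD,
    fun f => (hLn f).trans_eq (one_mul _), fun f => ⟨hdom f, ?_, rfl⟩⟩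
  refine coeff_ext fun n => ?_
  simp only [coeff_add, coeff_smul, coeff_num, hDc]
  have h1 : d n * (α * (n + 1 / 2) + K) = 1 := inv_mul_cancel₀ (hpos n).ne'
  have h2 : (d n : ℂ) * (α * (n + 1 / 2) + K) = 1 := by
    simpa using congrArg (fun x : ℝ => (x : ℂ)) h1
  linear_combination coeff n f * h2

/-- The inclusion of the component `j` in `ℂ² ⊗ L²(ℝ)`. -/
def incl (j : Fin 2) : L2 →L[ℂ] H :=
  ((PiLp.continuousLinearEquiv 2 ℂ fun _ : Fin 2 => L2).symm :
    (Fin 2 → L2) →L[ℂ] H) ∘L ContinuousLinearMap.single ℂ (fun _ : Fin 2 => L2) j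

theorem incl_apply (i j : Fin 2) (f : L2) : incl j f i = if i = j then f else 0 := by
  change (Pi.single j f : Fin 2 → L2) i = _
  rw [Pi.single_apply]

theorem isCompactOperator_conj_add {E F : Type*} [NormedAddCommGroup E] [NormedSpace ℂ E]
    [NormedAddCommGroup F] [NormedSpace ℂ F] {A B : E →L[ℂ] E} (hA : IsCompactOperator A)
    (hB : IsCompactOperator B) (i j : E →L[ℂ] F) (p q : F →L[ℂ] E) :
    IsCompactOperator (i ∘L (A ∘L p) + j ∘L (B ∘L q)) := by
  have h1 : IsCompactOperator (i ∘L (A ∘L p)) := (hA.comp_clm p).clm_comp i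
  have h2 : IsCompactOperator (j ∘L (B ∘L q)) := (hB.comp_clm q).clm_comp j
  exact h1.add h2

theorem exists_diag_clm (A B : L2 →L[ℂ] L2) :
    ∃ R : H →L[ℂ] H, (IsCompactOperator A → IsCompactOperator B → IsCompactOperator R) ∧
      (∀ f, R f 0 = A (f 0)) ∧ ∀ f, R f 1 = B (f 1) := by
  refine ⟨incl 0 ∘L (A ∘L PiLp.proj 2 (fun _ => L2) 0) +
    incl 1 ∘L (B ∘L PiLp.proj 2 (fun _ => L2) 1),
    fun hA hB => isCompactOperator_conj_add hA hB _ _ _ _, fun f => ?_, fun f => ?_⟩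
  · change incl 0 (A (f 0)) 0 + incl 1 (B (f 1)) 0 = _
    simp [incl_apply]
  · change incl 0 (A (f 0)) 1 + incl 1 (B (f 1)) 1 = _
    simp [incl_apply]

/-- With `A` and `B` equal to `(a - a*)` times the two diagonal resolvents, `T` is minus the
off-diagonal part of the oscillator composed with the inverse of the diagonal part. -/
theorem exists_offDiag_clm (A B : L2 →L[ℂ] L2) :
    ∃ T : H →L[ℂ] H, (∀ f, T f 0 = (1 / 2 : ℂ) • B (f 1)) ∧
      ∀ f, T f 1 = -((1 / 2 : ℂ) • A (f 0)) := by
  refine ⟨(1 / 2 : ℂ) • (incl 0 ∘L (B ∘L PiLp.proj 2 (fun _ => L2) 1) -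
    incl 1 ∘L (A ∘L PiLp.proj 2 (fun _ => L2) 0)), fun f => ?_, fun f => ?_⟩
  · change (1 / 2 : ℂ) • (incl 0 (B (f 1)) 0 - incl 1 (A (f 0)) 0) = _
    simp [incl_apply]
  · change (1 / 2 : ℂ) • (incl 0 (B (f 1)) 1 - incl 1 (A (f 0)) 1) = _
    simp [incl_apply]

/-- If `R₀` inverts the diagonal part plus `K`, then `(Q + K) R₀ = 1 - T` with `‖T‖ ≤ 1/2`, so `R₀
(1 - T)⁻¹` is a right inverse, compact because `R₀` is. -/
theorem exists_onePNcHO_resolvent {α β : ℝ} (hα : 0 < α) (hβ : 0 < β) :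
    ∃ (R : H →L[ℂ] H) (K : ℝ), HasCompactResolvent (onePNcHO α β) R K := by
  -- One shift that makes both `αK` and `βK` at least `2`.
  set K : ℝ := 2 / α + 2 / β with hKdef
  have hKα : 2 ≤ α * K := by
    rw [hKdef, mul_add, mul_div_cancel₀ _ hα.ne']
    have : 0 ≤ α * (2 / β) := by positivity
    linarith
  have hKβ : 2 ≤ β * K := by
    rw [hKdef, mul_add, mul_div_cancel₀ _ hβ.ne']
    have : 0 ≤ β * (2 / α) := by positivity
    linarith
  obtain ⟨D₀, W₀, hc₀, hW₀, hD₀⟩ := exists_num_resolvent hα hKα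
  obtain ⟨D₁, W₁, hc₁, hW₁, hD₁⟩ := exists_num_resolvent hβ hKβ
  obtain ⟨R₀, hR₀c, hR₀0, hR₀1⟩ := exists_diag_clm D₀ D₁
  obtain ⟨T, hT0, hT1⟩ := exists_offDiag_clm W₀ W₁
  have hTn : ‖T‖ < 1 := by
    refine lt_of_le_of_lt (T.opNorm_le_bound (by norm_num : (0 : ℝ) ≤ 1 / 2) fun f => ?_)
      (by norm_num : (1 / 2 : ℝ) < 1)
    refine (sq_le_sq₀ (norm_nonneg _) (by positivity)).1 ?_
    rw [mul_pow, PiLp.norm_sq_eq_of_L2, PiLp.norm_sq_eq_of_L2, Fin.sum_univ_two, Fin.sum_univ_two,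
      hT0, hT1, norm_neg, norm_smul, norm_smul, mul_pow, mul_pow]
    have h0 := pow_le_pow_left₀ (norm_nonneg _) (hW₀ (f 0)) 2
    have h1 := pow_le_pow_left₀ (norm_nonneg _) (hW₁ (f 1)) 2
    norm_num
    linarith
  obtain ⟨S, hS⟩ : ∃ S : H →L[ℂ] H, ∀ f, S f - T (S f) = f := by
    refine ⟨(↑(Units.oneSub T hTn)⁻¹ : H →L[ℂ] H), fun f => ?_⟩
    exact congrArg (fun A : H →L[ℂ] H => A f) (Units.oneSub T hTn).mul_inv
  refine ⟨R₀ ∘L S, K, HasCompactResolvent.of_symmetric (onePNcHO_symmetric α β) (fun f => ?_)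
    ((hR₀c hc₀ hc₁).comp_clm S)⟩
  set g := S f with hg
  obtain ⟨a0, a1, a2⟩ := hD₀ (g 0)
  obtain ⟨b0, b1, b2⟩ := hD₁ (g 1)
  have hd : ∀ j, R₀ g j ∈ num.domain := by
    intro j
    fin_cases j
    · exact (hR₀0 g).symm ▸ a0
    · exact (hR₀1 g).symm ▸ b0
  have hd' := (mem_domain_onePNcHO (α := α) (β := β)).2 hd
  refine ⟨hd', ?_⟩
  change onePNcHO α β ⟨R₀ g, hd'⟩ + (K : ℂ) • R₀ g = f
  conv_rhs => rw [← hS f]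
  simp only [← hR₀0] at a1 a2
  simp only [← hR₀1] at b1 b2
  ext1 j
  fin_cases j
  · change onePNcHO α β ⟨R₀ g, hd'⟩ 0 + (K : ℂ) • R₀ g 0 = g 0 - T g 0
    rw [onePNcHO_apply_zero hd' hd, hT0, ← b2, sub_add_eq_add_sub, a1]
  · change onePNcHO α β ⟨R₀ g, hd'⟩ 1 + (K : ℂ) • R₀ g 1 = g 1 - T g 1
    rw [onePNcHO_apply_one hd' hd, hT1, ← a2, sub_neg_eq_add, add_right_comm, b1]

end Oscillator

/-! ### Diagonal unitaries and `e^{-i (π/2) a* a}` -/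

section Phase

theorem coeff_hermiteBasis (n m : ℕ) : coeff n (hermiteBasis m) = if n = m then 1 else 0 :=
  orthonormal_iff_ite.1 hermiteBasis.orthonormal n m

theorem conj_mul_self_of_norm_one {z : ℂ} (hz : ‖z‖ = 1) : starRingEnd ℂ z * z = 1 := by
  rw [Complex.conj_mul', hz]
  norm_num

/-- The Hermite basis multiplied by the phases `z n`. -/
def phaseBasis (z : ℕ → ℂ) (hz : ∀ n, ‖z n‖ = 1) : HilbertBasis ℕ ℂ L2 :=
  HilbertBasis.mkOfOrthogonalEqBot (v := fun n => z n • hermiteBasis n)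
    (orthonormal_iff_ite.2 fun i j => by
      rw [inner_smul_left, inner_smul_right, orthonormal_iff_ite.1 hermiteBasis.orthonormal]
      split_ifs with h
      · subst h
        rw [mul_one, conj_mul_self_of_norm_one (hz i)]
      · simp)
    (by
      rw [eq_bot_iff]
      intro f hf
      refine coeff_ext fun n => ?_
      have h1 : inner ℂ (z n • hermiteBasis n) f = 0 :=
        (Submodule.mem_orthogonal _ _).1 hf _ (Submodule.subset_span ⟨n, rfl⟩)
      have h0 : z n ≠ 0 := by
        rw [← norm_ne_zero_iff, hz]; norm_num
      rw [inner_smul_left, mul_eq_zero, map_eq_zero] at h1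
      exact (h1.resolve_left h0).trans (inner_zero_right _).symm)

/-- The unitary operator multiplying the Hermite coefficients by the phases `z n`. -/
def phaseEquiv (z : ℕ → ℂ) (hz : ∀ n, ‖z n‖ = 1) : L2 ≃ₗᵢ[ℂ] L2 :=
  hermiteBasis.repr.trans (phaseBasis z hz).repr.symm

theorem coeff_phaseEquiv (z : ℕ → ℂ) (hz : ∀ n, ‖z n‖ = 1) (n : ℕ) (f : L2) :
    coeff n (phaseEquiv z hz f) = z n * coeff n f := by
  have h1 : (phaseBasis z hz).repr (phaseEquiv z hz f) = hermiteBasis.repr f := by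
    simp [phaseEquiv]
  have h2 := congrArg (fun w => w n) h1
  simp only [HilbertBasis.repr_apply_apply] at h2
  rw [phaseBasis, HilbertBasis.coe_mkOfOrthogonalEqBot, inner_smul_left] at h2
  rw [coeff, coeff, ← h2, ← mul_assoc, mul_comm (z n), conj_mul_self_of_norm_one (hz n), one_mul]

theorem norm_coeff_phaseEquiv (z : ℕ → ℂ) (hz : ∀ n, ‖z n‖ = 1) (n : ℕ) (f : L2) :
    ‖coeff n (phaseEquiv z hz f)‖ = ‖coeff n f‖ := by
  rw [coeff_phaseEquiv, norm_mul, hz, one_mul]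

theorem phaseEquiv_mem_domain_num (z : ℕ → ℂ) (hz : ∀ n, ‖z n‖ = 1) {f : L2} :
    phaseEquiv z hz f ∈ num.domain ↔ f ∈ num.domain := by
  simp only [mem_domain_num_iff, norm_coeff_phaseEquiv]

theorem num_phaseEquiv (z : ℕ → ℂ) (hz : ∀ n, ‖z n‖ = 1) {f : L2} (hf : f ∈ num.domain)
    (hf' : phaseEquiv z hz f ∈ num.domain) :
    num ⟨phaseEquiv z hz f, hf'⟩ = phaseEquiv z hz (num ⟨f, hf⟩) := by
  refine coeff_ext fun n => ?_
  rw [coeff_num, coeff_phaseEquiv, coeff_phaseEquiv, coeff_num]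
  ring

/-- Since `a` lowers the index, `a z(N) = z(N + 1) a`; the factor `c` compares the shifted phases
with another family `w`. -/
theorem ann_phaseEquiv {z w : ℕ → ℂ} (hz : ∀ n, ‖z n‖ = 1) (hw : ∀ n, ‖w n‖ = 1) {c : ℂ}
    (h : ∀ n, z (n + 1) = c * w n) {f : L2} (hf : f ∈ ann.domain)
    (hf' : phaseEquiv z hz f ∈ ann.domain) :
    ann ⟨phaseEquiv z hz f, hf'⟩ = c • phaseEquiv w hw (ann ⟨f, hf⟩) := by
  refine coeff_ext fun n => ?_
  rw [coeff_ann, coeff_phaseEquiv, coeff_smul, coeff_phaseEquiv, coeff_ann, h]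
  ring

theorem cre_phaseEquiv {z w : ℕ → ℂ} (hz : ∀ n, ‖z n‖ = 1) (hw : ∀ n, ‖w n‖ = 1) {c : ℂ}
    (h : ∀ n, z n = c * w (n + 1)) {f : L2} (hf : f ∈ cre.domain)
    (hf' : phaseEquiv z hz f ∈ cre.domain) :
    cre ⟨phaseEquiv z hz f, hf'⟩ = c • phaseEquiv w hw (cre ⟨f, hf⟩) := by
  refine coeff_ext fun n => ?_
  rw [coeff_smul, coeff_phaseEquiv]
  cases n with
  | zero => rw [coeff_cre_zero, coeff_cre_zero]; simp
  | succ n =>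
    rw [coeff_cre_succ, coeff_cre_succ, coeff_phaseEquiv, h]
    ring

theorem coeff_eq_zero_of_mem_eigenspace_num {z : ℂ} {f : L2} (hf : f ∈ eigenspace num z) (n : ℕ)
    (hn : (n : ℂ) ≠ z) :
    coeff n f = 0 := by
  obtain ⟨h1, h2⟩ := hf
  have h3 := congrArg (coeff n) h2
  rw [coeff_num, coeff_smul] at h3
  have h4 : ((n : ℂ) - z) * coeff n f = 0 := by linear_combination h3
  exact (mul_eq_zero.1 h4).resolve_left (sub_ne_zero.2 hn)

theorem hermiteBasis_mem_eigenspace (n : ℕ) : hermiteBasis n ∈ eigenspace num n := by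
  have h : hermiteBasis n ∈ num.domain := by
    rw [mem_domain_num_iff]
    refine summable_of_ne_finset_zero (s := {n}) fun m hm => ?_
    rw [coeff_hermiteBasis, if_neg (by simpa using hm)]
    simp
  refine ⟨h, coeff_ext fun m => ?_⟩
  rw [coeff_num, coeff_smul, coeff_hermiteBasis]
  split_ifs with e
  · rw [e]
  · simp

theorem eigenProj_num_natCast (n : ℕ) (f : L2) :
    eigenProj num n f = coeff n f • hermiteBasis n := by
  refine Submodule.eq_starProjection_of_mem_orthogonal
    (Submodule.smul_mem _ _ (Submodule.le_topologicalClosure _ (hermiteBasis_mem_eigenspace n))) ?_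
  rw [Submodule.orthogonal_closure]
  intro g hg
  rw [← (hasSum_coeff g _).tsum_eq]
  convert tsum_zero with m
  by_cases hm : m = n
  · subst hm
    rw [coeff_sub, coeff_smul, coeff_hermiteBasis, if_pos rfl]
    ring
  · rw [coeff_eq_zero_of_mem_eigenspace_num hg m (by exact_mod_cast hm)]
    simp

theorem eigenProj_num_eq_zero {z : ℂ} (hz : ∀ n : ℕ, (n : ℂ) ≠ z) (f : L2) :
    eigenProj num z f = 0 := by
  refine Submodule.eq_starProjection_of_mem_orthogonal (Submodule.zero_mem _) ?_
  rw [Submodule.orthogonal_closure]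
  intro g hg
  have : g = 0 := coeff_ext fun n => by
    rw [coeff_eq_zero_of_mem_eigenspace_num hg n (hz n)]
    exact (inner_zero_right _).symm
  rw [this, inner_zero_left]

theorem norm_neg_I_pow (n : ℕ) : ‖(-Complex.I) ^ n‖ = 1 := by simp

theorem expNegI_num_eq (f : L2) :
    expNegI num (Real.pi / 2) f = phaseEquiv (fun n => (-Complex.I) ^ n) norm_neg_I_pow f := by
  have hexp : ∀ n : ℕ, Complex.exp (-(Complex.I * (Real.pi / 2 : ℝ) * (n : ℝ))) =
      (-Complex.I) ^ n := fun n => by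
    rw [← Complex.exp_neg_pi_div_two_mul_I, ← Complex.exp_nat_mul]
    congr 1
    push_cast
    ring
  -- The sum over all real `μ` reduces to the natural numbers, since the other projections vanish.
  rw [expNegI, ← (Nat.cast_injective (R := ℝ)).tsum_eq]
  · have h1 := hermiteBasis.hasSum_repr
      (phaseEquiv (fun n => (-Complex.I) ^ n) norm_neg_I_pow f)
    rw [← h1.tsum_eq]
    refine tsum_congr fun n => ?_
    rw [hexp, Complex.ofReal_natCast, eigenProj_num_natCast, smul_smul,
      HilbertBasis.repr_apply_apply]
    congr 1
    exact (coeff_phaseEquiv _ _ n f).symm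
  · intro μ hμ
    by_contra h
    refine hμ ?_
    change _ • eigenProj num μ f = 0
    rw [eigenProj_num_eq_zero, smul_zero]
    intro n hn
    exact h ⟨n, by exact_mod_cast hn⟩

end Phase

/-! ### The Rabi Hamiltonian and the unitary `c ⊗ e^{-i (π/2) a* a}` -/

section Rabi

theorem mem_domain_onePRabi {Δ g : ℝ} {f : H} :
    f ∈ (onePRabi Δ g).domain ↔ ∀ j, f j ∈ num.domain :=
  ⟨fun h j => (h.1.2 j).1, fun h => ⟨⟨fun _ => trivial, fun j => ⟨h j, trivial⟩⟩,
    fun j => ⟨domain_num_le (h j), domain_num_le (h j)⟩⟩⟩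

/-- The operator `a + a*` on `D(a)`. -/
def annAddCre (f : ann.domain) : L2 := ann f + cre f

theorem onePRabi_apply {Δ g : ℝ} {f : H} (hf : f ∈ (onePRabi Δ g).domain) (i : Fin 2) :
    onePRabi Δ g ⟨f, hf⟩ i = (Δ : ℂ) • tensor sigmaZ one ⟨f, hf.1.1⟩ i +
      tensor 1 (num + (1 / 2 : ℂ) • one) ⟨f, hf.1.2⟩ i +
      (g : ℂ) • tensor sigmaX (ann + cre) ⟨f, hf.2⟩ i := rfl

theorem onePRabi_apply_zero {Δ g : ℝ} {f : H} (hf : f ∈ (onePRabi Δ g).domain)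
    (h : ∀ j, f j ∈ num.domain) :
    onePRabi Δ g ⟨f, hf⟩ 0 = (Δ : ℂ) • f 0 + (num ⟨f 0, h 0⟩ + (1 / 2 : ℂ) • f 0) +
      (g : ℂ) • annAddCre ⟨f 1, domain_num_le (h 1)⟩ := by
  rw [onePRabi_apply, tensor_apply, tensor_apply, tensor_apply, Fin.sum_univ_two, Fin.sum_univ_two,
    Fin.sum_univ_two]
  simp only [sigmaZ, sigmaX, Matrix.of_apply, Matrix.cons_val', Matrix.cons_val_zero,
    Matrix.cons_val_one, Matrix.cons_val_fin_one, Matrix.one_apply_eq, zero_smul, add_zero,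
    zero_add, one_smul, Matrix.one_apply_ne (by decide : (0 : Fin 2) ≠ 1)]
  rfl

theorem onePRabi_apply_one {Δ g : ℝ} {f : H} (hf : f ∈ (onePRabi Δ g).domain)
    (h : ∀ j, f j ∈ num.domain) :
    onePRabi Δ g ⟨f, hf⟩ 1 = -((Δ : ℂ) • f 1) + (num ⟨f 1, h 1⟩ + (1 / 2 : ℂ) • f 1) +
      (g : ℂ) • annAddCre ⟨f 0, domain_num_le (h 0)⟩ := by
  rw [onePRabi_apply, tensor_apply, tensor_apply, tensor_apply, Fin.sum_univ_two, Fin.sum_univ_two,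
    Fin.sum_univ_two]
  simp only [sigmaZ, sigmaX, Matrix.of_apply, Matrix.cons_val', Matrix.cons_val_zero,
    Matrix.cons_val_one, Matrix.cons_val_fin_one, Matrix.one_apply_eq, zero_smul, add_zero,
    zero_add, one_smul, neg_smul, smul_neg, Matrix.one_apply_ne (by decide : (1 : Fin 2) ≠ 0)]
  rfl

/-- The phase `e^{iπ/4}`. -/
def eighthRoot : ℂ := Complex.exp (Complex.I * (Real.pi / 4))

theorem norm_eighthRoot : ‖eighthRoot‖ = 1 := by
  have : eighthRoot = Complex.exp ((Real.pi / 4 : ℝ) * Complex.I) := by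
    rw [eighthRoot]; push_cast; rw [mul_comm]
  rw [this, Complex.norm_exp_ofReal_mul_I]

theorem eighthRoot_mul_self : eighthRoot * eighthRoot = Complex.I := by
  conv_rhs => rw [← Complex.exp_pi_div_two_mul_I]
  rw [eighthRoot, ← Complex.exp_add]
  congr 1
  ring

theorem eighthRoot_inv : eighthRoot⁻¹ = -Complex.I * eighthRoot := by
  refine inv_eq_of_mul_eq_one_left ?_
  rw [mul_assoc, eighthRoot_mul_self]
  simp

theorem matC_eq (α β : ℝ) :
    matC α β = !![(√α : ℂ) * eighthRoot, 0; 0, (√β : ℂ) * eighthRoot⁻¹] := by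
  have h1 : (Complex.I * (Real.pi / 4)) • sigmaZ =
      Matrix.diagonal ![Complex.I * (Real.pi / 4), -(Complex.I * (Real.pi / 4))] := by
    ext i j
    fin_cases i <;> fin_cases j <;> simp [sigmaZ]
  have h2 : NormedSpace.exp ![Complex.I * (Real.pi / 4 : ℂ), -(Complex.I * (Real.pi / 4))] =
      ![eighthRoot, eighthRoot⁻¹] := by
    rw [Pi.exp_def]
    funext i
    fin_cases i
    · simp [eighthRoot, Complex.exp_eq_exp_ℂ]
    · change NormedSpace.exp (-(Complex.I * (Real.pi / 4 : ℂ))) = eighthRoot⁻¹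
      rw [eighthRoot, ← Complex.exp_neg, Complex.exp_eq_exp_ℂ]
  rw [matC, h1, Matrix.exp_diagonal, h2]
  ext i j
  fin_cases i <;> fin_cases j <;> simp [Matrix.mul_apply, Fin.sum_univ_two]

/-- The phases of `e^{iπ/4} e^{-i (π/2) a* a}`. -/
def phaseUp (n : ℕ) : ℂ := eighthRoot * (-Complex.I) ^ n

/-- The phases of `e^{-iπ/4} e^{-i (π/2) a* a}`. -/
def phaseDown (n : ℕ) : ℂ := eighthRoot⁻¹ * (-Complex.I) ^ n

theorem norm_phaseUp (n : ℕ) : ‖phaseUp n‖ = 1 := by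
  rw [phaseUp, norm_mul, norm_eighthRoot, norm_neg_I_pow, one_mul]

theorem norm_phaseDown (n : ℕ) : ‖phaseDown n‖ = 1 := by
  rw [phaseDown, norm_mul, norm_inv, norm_eighthRoot, norm_neg_I_pow, inv_one, one_mul]

/-- The choice of `e^{iπ/4}` enters here: its inverse is `-i` times itself, so a shift of the index
exchanges the two phase families, up to a sign in the other direction. That sign is what turns `a -
a*` into `±(a + a*)`. -/
theorem phaseUp_succ (n : ℕ) : phaseUp (n + 1) = phaseDown n := by
  rw [phaseUp, phaseDown, eighthRoot_inv, pow_succ]; ring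

theorem phaseDown_succ (n : ℕ) : phaseDown (n + 1) = -phaseUp n := by
  rw [phaseUp, phaseDown, eighthRoot_inv, pow_succ]
  linear_combination eighthRoot * (-Complex.I) ^ n * Complex.I_mul_I

/-- `e^{iπ/4} e^{-i (π/2) a* a}` -/
def unitUp : L2 ≃ₗᵢ[ℂ] L2 := phaseEquiv phaseUp norm_phaseUp

/-- `e^{-iπ/4} e^{-i (π/2) a* a}` -/
def unitDown : L2 ≃ₗᵢ[ℂ] L2 := phaseEquiv phaseDown norm_phaseDown

theorem annAddCre_unitUp {f : L2} (hf : f ∈ ann.domain) (hf' : unitUp f ∈ ann.domain) :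
    annAddCre ⟨unitUp f, hf'⟩ = unitDown (annSubCre ⟨f, hf⟩) := by
  have h1 := ann_phaseEquiv (c := 1) norm_phaseUp norm_phaseDown
    (fun n => by rw [phaseUp_succ, one_mul]) hf hf'
  have h2 := cre_phaseEquiv (c := -1) norm_phaseUp norm_phaseDown
    (fun n => by rw [phaseDown_succ]; ring) hf hf'
  rw [annSubCre, map_sub, sub_eq_add_neg]
  exact congrArg₂ (· + ·) (h1.trans (one_smul _ _)) (h2.trans (neg_one_smul _ _))

theorem annAddCre_unitDown {f : L2} (hf : f ∈ ann.domain) (hf' : unitDown f ∈ ann.domain) :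
    annAddCre ⟨unitDown f, hf'⟩ = -unitUp (annSubCre ⟨f, hf⟩) := by
  have h1 := ann_phaseEquiv (c := -1) norm_phaseDown norm_phaseUp
    (fun n => by rw [phaseDown_succ]; ring) hf hf'
  have h2 := cre_phaseEquiv (c := 1) norm_phaseDown norm_phaseUp
    (fun n => by rw [phaseUp_succ, one_mul]) hf hf'
  rw [annSubCre, map_sub, neg_sub, sub_eq_add_neg, add_comm]
  exact congrArg₂ (· + ·) (h1.trans (neg_one_smul _ _)) (h2.trans (one_smul _ _))

theorem num_smul {c : ℂ} {f : L2} (hf : f ∈ num.domain) (hf' : c • f ∈ num.domain) :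
    num ⟨c • f, hf'⟩ = c • num ⟨f, hf⟩ := num.map_smul c ⟨f, hf⟩

theorem annAddCre_smul {c : ℂ} {f : L2} (hf : f ∈ ann.domain) (hf' : c • f ∈ ann.domain) :
    annAddCre ⟨c • f, hf'⟩ = c • annAddCre ⟨f, hf⟩ := by
  rw [annAddCre, annAddCre, smul_add]
  exact congrArg₂ (· + ·) (ann.map_smul c ⟨f, hf⟩) (cre.map_smul c ⟨f, hf⟩)

variable (α β : ℝ) (hα : 0 < α) (hβ : 0 < β)

/-- The operator `c ⊗ e^{-i (π/2) a* a}` as a unitary operator onto the weighted space. -/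
def weightedEquiv : H ≃ₗᵢ[ℂ] HW α β hα hβ :=
  (LinearIsometryEquiv.piLpCongrRight 2 (α := fun _ : Fin 2 => L2) (β := fun _ : Fin 2 => L2)
    ![unitUp, unitDown]).trans (sqrtGamma α β hα hβ).symm

theorem weightedEquiv_zero (f : H) :
    (toHW α β hα hβ).symm (weightedEquiv α β hα hβ f) 0 = (√α : ℂ) • unitUp (f 0) := rfl

theorem weightedEquiv_one (f : H) :
    (toHW α β hα hβ).symm (weightedEquiv α β hα hβ f) 1 = (√β : ℂ) • unitDown (f 1) := rfl

theorem weightedEquiv_eq_tildeI (f : H) : weightedEquiv α β hα hβ f = tildeI α β hα hβ f := by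
  apply (toHW α β hα hβ).symm.injective
  rw [tildeI, LinearEquiv.symm_apply_apply]
  ext1 i
  fin_cases i
  · refine (weightedEquiv_zero α β hα hβ f).trans ?_
    refine coeff_ext fun n => ?_
    change _ = coeff n (∑ j : Fin 2, matC α β 0 j • expNegI num (Real.pi / 2) (f j))
    simp only [Fin.sum_univ_two, matC_eq, expNegI_num_eq, coeff_smul, coeff_add, unitUp,
      coeff_phaseEquiv, phaseUp]
    simp
    ring
  · refine (weightedEquiv_one α β hα hβ f).trans ?_
    refine coeff_ext fun n => ?_
    change _ = coeff n (∑ j : Fin 2, matC α β 1 j • expNegI num (Real.pi / 2) (f j))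
    simp only [Fin.sum_univ_two, matC_eq, expNegI_num_eq, coeff_smul, coeff_add, unitDown,
      coeff_phaseEquiv, phaseDown]
    simp
    ring

end Rabi

-- Intertwining of the oscillator with the Rabi Hamiltonians

section Intertwining

variable (α β : ℝ) (hα : 0 < α) (hβ : 0 < β)

theorem ofReal_sqrt_mul_self {x : ℝ} (hx : 0 < x) : ((√x : ℝ) : ℂ) * (√x : ℝ) = x := by
  rw [← Complex.ofReal_mul, Real.mul_self_sqrt hx.le]

theorem ofReal_sqrt_ne_zero {x : ℝ} (hx : 0 < x) : ((√x : ℝ) : ℂ) ≠ 0 := by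
  exact_mod_cast (Real.sqrt_pos.2 hx).ne'

theorem weightedEquiv_mem_domain_num (f : H) :
    (∀ j, (toHW α β hα hβ).symm (weightedEquiv α β hα hβ f) j ∈ num.domain) ↔
      ∀ j, f j ∈ num.domain := by
  rw [Fin.forall_fin_two, Fin.forall_fin_two, weightedEquiv_zero, weightedEquiv_one,
    Submodule.smul_mem_iff _ (ofReal_sqrt_ne_zero hα),
    Submodule.smul_mem_iff _ (ofReal_sqrt_ne_zero hβ)]
  exact and_congr (phaseEquiv_mem_domain_num _ _) (phaseEquiv_mem_domain_num _ _)

/-- One factor `√α` comes from `c` and the other multiplies the row, which restores the coefficient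
`α` of the oscillator. -/
theorem onePRabiAt_weightedEquiv_zero {l : ℝ} {f : H} (hf : f ∈ (onePNcHO α β).domain)
    (hf' : (toHW α β hα hβ).symm (weightedEquiv α β hα hβ f) ∈ (onePRabiAt α β l).domain) :
    (√α : ℂ) • (onePRabiAt α β l ⟨_, hf'⟩ 0 - (((α + β) / (2 * α * β) * l : ℝ) : ℂ) •
      (toHW α β hα hβ).symm (weightedEquiv α β hα hβ f) 0) =
    unitUp (onePNcHO α β ⟨f, hf⟩ 0 - (l : ℂ) • f 0) := by
  have hd := mem_domain_onePNcHO.1 hf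
  have hd' := (weightedEquiv_mem_domain_num α β hα hβ f).2 hd
  have hU : unitUp (f 0) ∈ num.domain := (phaseEquiv_mem_domain_num _ _).2 (hd 0)
  have hD : unitDown (f 1) ∈ num.domain := (phaseEquiv_mem_domain_num _ _).2 (hd 1)
  have e1 : num ⟨_, hd' 0⟩ = (√α : ℂ) • unitUp (num ⟨f 0, hd 0⟩) :=
    (num_smul hU (hd' 0)).trans (congrArg _ (num_phaseEquiv _ norm_phaseUp (hd 0) hU))
  have e2 : annAddCre ⟨_, domain_num_le (hd' 1)⟩ =
      (√β : ℂ) • -unitUp (annSubCre ⟨f 1, domain_num_le (hd 1)⟩) :=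
    (annAddCre_smul (domain_num_le hD) (domain_num_le (hd' 1))).trans
      (congrArg _ (annAddCre_unitDown (domain_num_le (hd 1)) (domain_num_le hD)))
  have e3 := onePRabi_apply_zero hf' hd'
  rw [e1, e2] at e3
  rw [onePNcHO_apply_zero hf hd]
  refine (congrArg (fun x => (√α : ℂ) • (x - _)) e3).trans ?_
  rw [weightedEquiv_zero]
  simp only [map_sub, map_add, map_smul]
  have hs := ofReal_sqrt_mul_self hα
  have ht := ofReal_sqrt_mul_self hβ
  have hs0 := ofReal_sqrt_ne_zero hα
  have ht0 := ofReal_sqrt_ne_zero hβ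
  -- In terms of `s = √α` and `t = √β` the scalars are rational: the coupling is `√α · g · √β =
  -- 1/2`, and `Δ - (α+β)l/(2αβ) = -l/α`.
  rw [Real.sqrt_mul hα.le]
  push_cast
  generalize ((√α : ℝ) : ℂ) = s at *
  generalize ((√β : ℝ) : ℂ) = t at *
  rw [← hs, ← ht]
  match_scalars <;> field_simp
  ring

theorem onePRabiAt_weightedEquiv_one {l : ℝ} {f : H} (hf : f ∈ (onePNcHO α β).domain)
    (hf' : (toHW α β hα hβ).symm (weightedEquiv α β hα hβ f) ∈ (onePRabiAt α β l).domain) :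
    (√β : ℂ) • (onePRabiAt α β l ⟨_, hf'⟩ 1 - (((α + β) / (2 * α * β) * l : ℝ) : ℂ) •
      (toHW α β hα hβ).symm (weightedEquiv α β hα hβ f) 1) =
    unitDown (onePNcHO α β ⟨f, hf⟩ 1 - (l : ℂ) • f 1) := by
  have hd := mem_domain_onePNcHO.1 hf
  have hd' := (weightedEquiv_mem_domain_num α β hα hβ f).2 hd
  have hU : unitUp (f 0) ∈ num.domain := (phaseEquiv_mem_domain_num _ _).2 (hd 0)
  have hD : unitDown (f 1) ∈ num.domain := (phaseEquiv_mem_domain_num _ _).2 (hd 1)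
  have e1 : num ⟨_, hd' 1⟩ = (√β : ℂ) • unitDown (num ⟨f 1, hd 1⟩) :=
    (num_smul hD (hd' 1)).trans (congrArg _ (num_phaseEquiv _ norm_phaseDown (hd 1) hD))
  have e2 : annAddCre ⟨_, domain_num_le (hd' 0)⟩ =
      (√α : ℂ) • unitDown (annSubCre ⟨f 0, domain_num_le (hd 0)⟩) :=
    (annAddCre_smul (domain_num_le hU) (domain_num_le (hd' 0))).trans
      (congrArg _ (annAddCre_unitUp (domain_num_le (hd 0)) (domain_num_le hU)))
  have e3 := onePRabi_apply_one hf' hd'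
  rw [e1, e2] at e3
  rw [onePNcHO_apply_one hf hd]
  refine (congrArg (fun x => (√β : ℂ) • (x - _)) e3).trans ?_
  rw [weightedEquiv_one]
  simp only [map_sub, map_add, map_smul]
  have hs := ofReal_sqrt_mul_self hα
  have ht := ofReal_sqrt_mul_self hβ
  have hs0 := ofReal_sqrt_ne_zero hα
  have ht0 := ofReal_sqrt_ne_zero hβ
  -- As in the upper component, but `-Δ - (α+β)l/(2αβ) = -l/β`.
  rw [Real.sqrt_mul hα.le]
  push_cast
  generalize ((√α : ℝ) : ℂ) = s at *
  generalize ((√β : ℝ) : ℂ) = t at *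
  rw [← hs, ← ht]
  match_scalars <;> field_simp
  ring

/-- `f` is an eigenvector of the oscillator for `l` if and only if its image is an eigenvector of
the Rabi Hamiltonian with parameter `l`. -/
theorem eigenspace_rabiHW (l : ℝ) :
    eigenspace (rabiHW α β hα hβ l) ((α + β) / (2 * α * β) * l : ℝ) =
      eigenspace (conj (weightedEquiv α β hα hβ).toLinearEquiv (onePNcHO α β)) (l : ℝ) := by
  ext g
  obtain ⟨f, rfl⟩ := (weightedEquiv α β hα hβ).surjective g
  have hs0 := ofReal_sqrt_ne_zero hα
  have ht0 := ofReal_sqrt_ne_zero hβ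
  have key : weightedEquiv α β hα hβ f ∈
        eigenspace (rabiHW α β hα hβ l) ((α + β) / (2 * α * β) * l : ℝ) ↔
      f ∈ eigenspace (onePNcHO α β) (l : ℝ) := by
    have hdom : (toHW α β hα hβ).symm (weightedEquiv α β hα hβ f) ∈ (onePRabiAt α β l).domain ↔
        f ∈ (onePNcHO α β).domain :=
      mem_domain_onePRabi.trans ((weightedEquiv_mem_domain_num α β hα hβ f).trans
        mem_domain_onePNcHO.symm)
    have heq : ∀ (hf' : (toHW α β hα hβ).symm (weightedEquiv α β hα hβ f) ∈
        (onePRabiAt α β l).domain) (hf : f ∈ (onePNcHO α β).domain),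
        onePRabiAt α β l ⟨_, hf'⟩ = (((α + β) / (2 * α * β) * l : ℝ) : ℂ) •
          (toHW α β hα hβ).symm (weightedEquiv α β hα hβ f) ↔
        onePNcHO α β ⟨f, hf⟩ = (l : ℂ) • f := fun hf' hf => by
      have h0 := onePRabiAt_weightedEquiv_zero α β hα hβ hf hf'
      have h1 := onePRabiAt_weightedEquiv_one α β hα hβ hf hf'
      have i0 : onePRabiAt α β l ⟨_, hf'⟩ 0 - (((α + β) / (2 * α * β) * l : ℝ) : ℂ) •
          (toHW α β hα hβ).symm (weightedEquiv α β hα hβ f) 0 = 0 ↔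
          onePNcHO α β ⟨f, hf⟩ 0 - (l : ℂ) • f 0 = 0 := by
        rw [← smul_eq_zero_iff_right hs0, h0, map_eq_zero_iff _ unitUp.injective]
      have i1 : onePRabiAt α β l ⟨_, hf'⟩ 1 - (((α + β) / (2 * α * β) * l : ℝ) : ℂ) •
          (toHW α β hα hβ).symm (weightedEquiv α β hα hβ f) 1 = 0 ↔
          onePNcHO α β ⟨f, hf⟩ 1 - (l : ℂ) • f 1 = 0 := by
        rw [← smul_eq_zero_iff_right ht0, h1, map_eq_zero_iff _ unitDown.injective]
      rw [sub_eq_zero, sub_eq_zero] at i0 i1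
      rw [PiLp.ext_iff, PiLp.ext_iff, Fin.forall_fin_two, Fin.forall_fin_two]
      exact and_congr i0 i1
    constructor
    · rintro ⟨h1, h2⟩
      have hf' : (toHW α β hα hβ).symm (weightedEquiv α β hα hβ f) ∈ (onePRabiAt α β l).domain := h1
      exact ⟨hdom.1 hf', (heq hf' (hdom.1 hf')).1 h2⟩
    · rintro ⟨h1, h2⟩
      exact ⟨hdom.2 h1, (heq (hdom.2 h1) h1).2 h2⟩
  exact key.trans (map_mem_eigenspace_conj (weightedEquiv α β hα hβ).toLinearEquiv).symm

theorem eigenProj_congr {E : Type*} [NormedAddCommGroup E] [InnerProductSpace ℂ E]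
    [CompleteSpace E] {S T : E →ₗ.[ℂ] E} {w z : ℂ} (h : eigenspace S w = eigenspace T z) :
    eigenProj S w = eigenProj T z := by
  have key : ∀ U W : Submodule ℂ E, U = W →
      U.topologicalClosure.starProjection = W.topologicalClosure.starProjection := by
    rintro U _ rfl
    rfl
  exact key _ _ h

theorem mem_realSpectrum_of_conj (l : ℝ) (g : HW α β hα hβ)
    (hg : g ∈ eigenspace (conj (weightedEquiv α β hα hβ).toLinearEquiv (onePNcHO α β)) (l : ℝ))
    (h0 : g ≠ 0) : l ∈ realSpectrum (onePNcHO α β) := by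
  obtain ⟨f, rfl⟩ := (weightedEquiv α β hα hβ).toLinearEquiv.surjective g
  exact mem_opSpectrum ((map_mem_eigenspace_conj _).1 hg) fun e => h0 (by rw [e, map_zero])

/-- The projection lands in an eigenspace of the Rabi Hamiltonian, hence in its domain, where the
operator is a scalar. The fibre operator is thus everywhere defined, and only summability restricts
the domain of the direct sum. -/
theorem mem_domain_fiberOp (l : ℝ) (g : HW α β hα hβ)
    {R : HW α β hα hβ →L[ℂ] HW α β hα hβ} {K : ℝ}
    (hR : HasCompactResolvent
      (conj (weightedEquiv α β hα hβ).toLinearEquiv (onePNcHO α β)) R K) :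
    ∃ h : g ∈ (fiberOp α β hα hβ l).domain, fiberOp α β hα hβ l ⟨g, h⟩ =
      (((α + β) / (2 * α * β) : ℝ) : ℂ) • (l : ℂ) • eigenProj
        (conj (weightedEquiv α β hα hβ).toLinearEquiv (onePNcHO α β)) (l : ℝ) g := by
  have e := eigenspace_rabiHW α β hα hβ l
  have h1 := hR.eigenProj_mem (l : ℝ) g
  rw [← e, ← eigenProj_congr e] at h1
  rw [← eigenProj_congr e]
  obtain ⟨h2, h3⟩ := h1
  refine ⟨⟨trivial, h2⟩, ?_⟩
  rw [smul_smul, ← Complex.ofReal_mul]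
  exact h3

end Intertwining

end NcHO

end

-- The direct sum decomposition

theorem theorem4 (α β : ℝ) (hα : 0 < α) (hβ : 0 < β) :
    ∃ V : NcHO.H ≃ₗᵢ[ℂ] NcHO.HW α β hα hβ,
      (∀ f : NcHO.H, V f = NcHO.tildeI α β hα hβ f) ∧
      IsHilbertSum ℂ
        (fun l : NcHO.realSpectrum (NcHO.onePNcHO α β) => NcHO.fiberSpace α β hα hβ l)
        (fun l => (NcHO.fiberSpace α β hα hβ l).subtypeₗᵢ) ∧
      NcHO.conj V.toLinearEquiv (NcHO.onePNcHO α β) =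
        (2 * α * β / (α + β) : ℂ) • NcHO.directSumOp
          (fun l : NcHO.realSpectrum (NcHO.onePNcHO α β) => NcHO.fiberOp α β hα hβ l) := by
  obtain ⟨R, K, hR⟩ := NcHO.exists_onePNcHO_resolvent hα hβ
  have hT := hR.conj (NcHO.weightedEquiv α β hα hβ)
  have hS := NcHO.mem_realSpectrum_of_conj α β hα hβ
  refine ⟨NcHO.weightedEquiv α β hα hβ, NcHO.weightedEquiv_eq_tildeI α β hα hβ, ?_, ?_⟩
  · refine hT.isHilbertSum hS _ fun l => ?_
    rw [NcHO.fiberSpace, NcHO.eigenspace_rabiHW]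
    exact hT.topologicalClosure_eigenspace _
  · have hc : (2 * α * β / (α + β) : ℂ) * (((α + β) / (2 * α * β) : ℝ) : ℂ) = 1 := by
      have h1 : (2 * α * β / (α + β)) * ((α + β) / (2 * α * β)) = 1 := by field_simp
      exact_mod_cast h1
    have happ := fun (l : NcHO.realSpectrum (NcHO.onePNcHO α β)) (g : NcHO.HW α β hα hβ) =>
      NcHO.mem_domain_fiberOp α β hα hβ l g hT
    refine LinearPMap.ext ?_ ?_
    -- Both domains consist of the `g` for which `∑ l P_l g` converges, the nonzero constant being
    -- immaterial.
    · ext g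
      constructor
      · intro hg
        refine ⟨fun l => (happ l g).1, ?_⟩
        refine ((hT.hasSum_apply hS ⟨g, hg⟩).summable.const_smul
          (((α + β) / (2 * α * β) : ℝ) : ℂ)).congr fun l => ?_
        exact (happ l g).2.symm
      · rintro ⟨h1, h2⟩
        refine hT.mem_domain_of_summable hS ?_
        refine (h2.const_smul (2 * α * β / (α + β) : ℂ)).congr fun l => ?_
        refine (congrArg (fun x => (2 * α * β / (α + β) : ℂ) • x) (happ l g).2).trans ?_
        simp only [smul_smul, ← mul_assoc, hc, one_mul]
    · intro g hg hg'
      have h1 := ((hT.hasSum_apply hS ⟨g, hg⟩).const_smul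
        (((α + β) / (2 * α * β) : ℝ) : ℂ)).tsum_eq
      have h2 : NcHO.directSumOp (fun l : NcHO.realSpectrum (NcHO.onePNcHO α β) =>
          NcHO.fiberOp α β hα hβ l) ⟨g, hg'⟩ = _ := (tsum_congr fun l => (happ l g).2).trans h1
      rw [LinearPMap.smul_apply]
      refine Eq.trans ?_ (congrArg _ h2).symm
      rw [smul_smul, hc, one_smul]
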